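/- **Setting.** Let $A$ be a finite-dimensional real vector space. A (dynamical) state space on $A$ consists of: a nonempty compact convex set $\Omega_A\subset A$ of states such that $A_+:=\mathbb R_{\ge 0}\cdot\Omega_A$ is a closed generating cone; a linear functional $u_A$ that is strictly positive on $A_+\setminus\{0\}$ and satisfies, for $w\in A_+$, $u_A(w)=1\Leftrightarrow w\in\Omega_A$; a convex, closed set of allowed effects (an effect is a linear functional $e$ with $0\le e\le u_A$ on $A_+$) that spans $A^*$ and is closed under $e\mapsto u_A-e$, under sums $e+f\le u_A$, and under composition with reversible transformations; and a group $\mathcal G_A$ of invertible linear maps, the reversible transformations, all of which are transformations. A *transformation* is a linear map $T:A\to A$ with $T(A_+)\subset A_+$ and $u_A\circ T\le u_A$ on $A_+$; an *operation* is a finite family of transformations $T_j$ with $\sum_j u_A\circ T_j=u_A$. Pure states are the extreme points of $\Omega_A$. States $w_1,\dots,w_n$ are *perfectly distinguishable* if there are allowed effects $e_1,\dots,e_n$ with $\sum_j e_j\le u_A$ and $e_j(w_k)=\delta_{jk}$. A *frame* is a family of perfectly distinguishable pure states; it is *maximal* if it is not contained in a larger frame. A *face* of a convex set $C$ is a nonempty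 convex $F\subset C$ such that $v,w\in C$, $0<p<1$ and $pv+(1-p)w\in F$ imply $v,w\in F$. **Postulate 1.** Every state is a convex combination of the members of some frame. **Postulate 2.** For any two frames $w_1,\dots,w_n$ and $v_1,\dots,v_n$ of the same size there is $T\in\mathcal G_A$ with $Tw_j=v_j$ for all $j$. **Theorem.** Assume Postulates 1 and 2. Then there is an inner product $\langle\cdot,\cdot\rangle$ on $A$ that is self-dualizing (the functionals nonnegative on $A_+$ are exactly the $\langle\cdot,w\rangle$ with $w\in A_+$) and $\mathcal G_A$-invariant, with $0\le\langle w,v\rangle\le1$ for all states, $\langle w,w\rangle=1$ for pure $w$, $\langle w,w\rangle<1$ for mixed $w$, and $\langle w,v\rangle=0$ for perfectly distinguishable $w,v$, such that, with orthogonality understood with respect to it, the following hold. (a) Let $w_1,\dots,w_n\in\Omega_A$ be perfectly distinguishable, possibly mixed. Then there are $r\ge 0$, a frame $v_1,\dots,v_r$, and projectors $P_1,\dots,P_{n+r}$ forming an operation, such that $P_aP_b=0$ for $a\ne b$; for $j\le n$, $P_j$ is the orthogonal projection onto the linear span of $\mathbb R_{\ge0}\cdot F_j$, where $F_j$ is the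 minimal face of $\Omega_A$ containing $w_j$; for $i\le r$, $P_{n+i}$ is the orthogonal projection onto the linear span of $v_i$; each $P_a$ is positive and projects onto the linear span of a face of $A_+$; and for all $a\le n+r$, $k\le n$, $$u_A(P_a w_k)=\delta_{ak},\qquad P_a w_k=\delta_{ak}w_k .$$ (b) Let $w_1,\dots,w_n$ be a maximal frame. Then the orthogonal projections $P_j$ onto the linear spans of the faces $\mathbb R_{\ge0}\cdot\{w_j\}$ of $A_+$ are positive, satisfy $P_jP_k=0$ for $j\ne k$, and form an operation, and $u_A(P_jw_k)=\delta_{jk}$ and $P_jw_k=\delta_{jk}w_k$ for all $j,k$. -/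

import Mathlib

/-- The cone `ℝ≥0 · F` over a set `F` of vectors. -/
def coneOver {A : Type*} [AddCommGroup A] [Module ℝ A] (F : Set A) : Set A :=
  {x | ∃ c : ℝ, 0 ≤ c ∧ ∃ w ∈ F, x = c • w}

/-- `F` is a face of the convex set `C`: a nonempty convex subset of `C` that contains `v` and `w`
as soon as it contains a proper convex combination of `v, w ∈ C`. -/
def IsFace {A : Type*} [AddCommGroup A] [Module ℝ A] (C F : Set A) : Prop :=
  F.Nonempty ∧ Convex ℝ F ∧ F ⊆ C ∧
    ∀ v ∈ C, ∀ w ∈ C, ∀ p : ℝ, 0 < p → p < 1 → p • v + (1 - p) • w ∈ F → v ∈ F ∧ w ∈ F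

/-- The face of `C` generated by `M`, i.e. the minimal face of `C` containing `M`. -/
def generatedFace {A : Type*} [AddCommGroup A] [Module ℝ A] (C M : Set A) : Set A :=
  ⋂₀ {H | IsFace C H ∧ M ⊆ H}

/-- `P` is the orthogonal (i.e. `B`-symmetric) projection onto the subspace `V`, with respect to
the inner product `B`. -/
def IsOrthogonalProjection {A : Type*} [AddCommGroup A] [Module ℝ A]
    (B : LinearMap.BilinForm ℝ A) (P : A →ₗ[ℝ] A) (V : Submodule ℝ A) : Prop :=
  P ∘ₗ P = P ∧ LinearMap.range P = V ∧ ∀ x y, B (P x) y = B x (P y)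

/-- An abstract state space `(A, Ω, u)` on a finite-dimensional real vector space `A` (with its
unique Hausdorff vector space topology). That the set `coneOver Ω` is closed under addition and
under multiplication by nonnegative reals and contains no line follows from the fields below. -/
structure AbstractStateSpace (A : Type*) [AddCommGroup A] [Module ℝ A] [TopologicalSpace A] where
  /-- the set of normalized states -/
  Ω : Set A
  /-- the order unit, which gives the normalization -/
  u : Module.Dual ℝ A
  nonempty : Ω.Nonempty
  convex : Convex ℝ Ω
  isCompact : IsCompact Ω
  isClosed_cone : IsClosed (coneOver Ω)
  generating : Submodule.span ℝ (coneOver Ω) = ⊤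
  u_pos : ∀ w ∈ coneOver Ω, w ≠ 0 → 0 < u w
  u_eq_one_iff : ∀ w ∈ coneOver Ω, u w = 1 ↔ w ∈ Ω

namespace AbstractStateSpace

variable {A : Type*} [AddCommGroup A] [Module ℝ A] [TopologicalSpace A]

/-- The cone `A₊` of unnormalized states. -/
def cone (S : AbstractStateSpace A) : Set A := coneOver S.Ω

/-- The pure states are the extreme points of the set of normalized states. -/
def IsPure (S : AbstractStateSpace A) (w : A) : Prop := w ∈ S.Ω.extremePoints ℝ

/-- The order of functionals, pointwise on the cone of unnormalized states. -/
def FunctionalLE (S : AbstractStateSpace A) (e f : Module.Dual ℝ A) : Prop :=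
  ∀ w ∈ S.cone, e w ≤ f w

/-- The effects are the functionals `e` with `0 ≤ e ≤ u`. -/
def IsEffect (S : AbstractStateSpace A) (e : Module.Dual ℝ A) : Prop :=
  S.FunctionalLE 0 e ∧ S.FunctionalLE e S.u

/-- Transformations of the system: positive, normalization-non-increasing linear maps. -/
def IsTransformation (S : AbstractStateSpace A) (T : A →ₗ[ℝ] A) : Prop :=
  (∀ w ∈ S.cone, T w ∈ S.cone) ∧ S.FunctionalLE (S.u ∘ₗ T) S.u

/-- An operation is a finite family of transformations `T j` with `∑ j, u ∘ T j = u`. -/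
def IsOperation (S : AbstractStateSpace A) {ι : Type*} [Fintype ι] (T : ι → A →ₗ[ℝ] A) : Prop :=
  (∀ j, S.IsTransformation (T j)) ∧ ∑ j, S.u ∘ₗ T j = S.u

/-- A projective measurement (with respect to the inner product `B`): an operation consisting of
mutually orthogonal projectors, each of which is the orthogonal projection onto the linear span of
a face of the cone. The projectors are positive because an operation consists of
transformations. -/
def IsProjectiveMeasurement (S : AbstractStateSpace A) (B : LinearMap.BilinForm ℝ A)
    {ι : Type*} [Fintype ι] (P : ι → A →ₗ[ℝ] A) : Prop :=
  S.IsOperation P ∧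
  (∀ j, ∃ F, IsFace S.cone F ∧ IsOrthogonalProjection B (P j) (Submodule.span ℝ F)) ∧
  ∀ i j, i ≠ j → P i ∘ₗ P j = 0

end AbstractStateSpace

/-- A state space together with its set `allowed` of physically allowed effects and its group `G`
of reversible transformations (those physically allowed transformations whose inverse is also a
physically allowed transformation). -/
structure DynamicalStateSpace (A : Type*) [AddCommGroup A] [Module ℝ A] [TopologicalSpace A]
    extends AbstractStateSpace A where
  /-- the physically allowed effects -/
  allowed : Set (Module.Dual ℝ A)
  /-- the reversible transformations -/
  G : Subgroup (A ≃ₗ[ℝ] A)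
  allowed_isEffect : ∀ e ∈ allowed, toAbstractStateSpace.IsEffect e
  allowed_convex : Convex ℝ allowed
  /-- closed; the topology of pointwise convergence is the usual one of the dual space -/
  allowed_isClosed : IsClosed ((fun (e : Module.Dual ℝ A) (x : A) => e x) '' allowed)
  allowed_span : Submodule.span ℝ allowed = ⊤
  allowed_compl : ∀ e ∈ allowed, u - e ∈ allowed
  allowed_add : ∀ e ∈ allowed, ∀ f ∈ allowed,
    toAbstractStateSpace.FunctionalLE (e + f) u → e + f ∈ allowed
  allowed_comp : ∀ e ∈ allowed, ∀ T ∈ G, e ∘ₗ (T : A →ₗ[ℝ] A) ∈ allowed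
  G_isTransformation : ∀ T ∈ G, toAbstractStateSpace.IsTransformation (T : A →ₗ[ℝ] A)

namespace DynamicalStateSpace

variable {A : Type*} [AddCommGroup A] [Module ℝ A] [TopologicalSpace A]

/-- The states `w 0, …, w (n - 1)` are perfectly distinguishable: there are allowed effects `e j`
with `∑ j, e j ≤ u` and `e j (w k) = δ j k`. (Allowed effects with `∑ j, e j ≤ u` can appear in a
common allowed measurement.) -/
def PerfectlyDistinguishable (S : DynamicalStateSpace A) {n : ℕ} (w : Fin n → A) : Prop :=
  (∀ k, w k ∈ S.Ω) ∧
  ∃ e : Fin n → Module.Dual ℝ A, (∀ j, e j ∈ S.allowed) ∧ S.FunctionalLE (∑ j, e j) S.u ∧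
    ∀ j k, e j (w k) = if j = k then 1 else 0

/-- A frame: perfectly distinguishable pure states. -/
def IsFrame (S : DynamicalStateSpace A) {n : ℕ} (w : Fin n → A) : Prop :=
  S.PerfectlyDistinguishable w ∧ ∀ k, S.IsPure (w k)

/-- A maximal frame: a frame that is not contained in a larger frame. -/
def IsMaximalFrame (S : DynamicalStateSpace A) {n : ℕ} (w : Fin n → A) : Prop :=
  S.IsFrame w ∧
    ∀ (m : ℕ) (v : Fin m → A), S.IsFrame v → Set.range w ⊆ Set.range v → m ≤ n

/-- Postulate 1, classical decomposability: every state is a mixture of perfectly distinguishable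
pure states. -/
def ClassicalDecomposability (S : DynamicalStateSpace A) : Prop :=
  ∀ w ∈ S.Ω, ∃ (n : ℕ) (p : Fin n → ℝ) (v : Fin n → A),
    (∀ j, 0 ≤ p j) ∧ ∑ j, p j = 1 ∧ S.IsFrame v ∧ w = ∑ j, p j • v j

/-- Postulate 2, strong symmetry: any two families of `n` perfectly distinguishable pure states
are related by a reversible transformation. -/
def StrongSymmetry (S : DynamicalStateSpace A) : Prop :=
  ∀ (n : ℕ) (w v : Fin n → A), S.IsFrame w → S.IsFrame v → ∃ T ∈ S.G, ∀ j, T (w j) = v j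

/-- `B` is a self-dualizing inner product which is invariant under the reversible transformations,
takes values in `[0, 1]` on pairs of states, normalizes exactly the pure states, and makes
perfectly distinguishable states orthogonal. -/
structure IsSelfDualizing (S : DynamicalStateSpace A) (B : LinearMap.BilinForm ℝ A) : Prop where
  symm : ∀ x y, B x y = B y x
  pos : ∀ x, x ≠ 0 → 0 < B x x
  selfDual : ∀ e : Module.Dual ℝ A,
    (∀ x ∈ S.cone, 0 ≤ e x) ↔ ∃ w ∈ S.cone, ∀ x, e x = B x w
  invariant : ∀ T ∈ S.G, ∀ x y, B (T x) (T y) = B x y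
  mem_Icc : ∀ w ∈ S.Ω, ∀ v ∈ S.Ω, 0 ≤ B w v ∧ B w v ≤ 1
  pure : ∀ w, S.IsPure w → B w w = 1
  mixed : ∀ w ∈ S.Ω, ¬ S.IsPure w → B w w < 1
  orthogonal : ∀ w v, S.PerfectlyDistinguishable ![w, v] → B w v = 0

end DynamicalStateSpace

-- The two postulates force a spectral theory on `A`. By strong symmetry every frame extends to one
-- of the maximal size `N`, and all frames of that size have the same sum `c`: an invariant state
-- has equal weights in its frame decomposition. Adding a multiple of `c` makes any vector positive,
-- so every vector, not only every state, is diagonal in a frame of size `N`.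
--
-- A fixed point argument yields an invariant inner product. Strong symmetry makes it constant on
-- pure states and on pairs from frames, so subtracting a multiple of `u ⊗ u` and rescaling makes
-- frames orthonormal (`exists_isFrameForm`). Then `c` represents `u`, and the equality case of
-- Cauchy–Schwarz shows that a pure state represents its own distinguishing effect
-- (`flip_mem_allowed`). Self-duality follows, and frames turn out to be the same as orthogonal
-- families of pure states (`isFrame_of_isOrthoPure`).
--
-- A sum `d` of orthogonal pure states exposes the face of the cone where `B d = u`. Elements of
-- this face are diagonal in families that sum to `d`, so the face is self-dual in its span
-- (`mem_faceCone_of_nonneg`). Hence the orthogonal projection `P` onto the span is positive, and `u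
-- ∘ P = B d`. Units `d a` that are orthogonal and sum to `c` therefore give projective measurements
-- (`exists_projectiveMeasurement`). For distinguishable states the units come from the faces that
-- they generate, completed by a frame; for a maximal frame they are its members.

-- Fixed points of linear group actions with bounded orbits

/-- The supremum of the squared norm over the orbit is an invariant, uniformly convex function, so
its minimizer on `C` is unique and hence fixed. No topology on the group and no Haar measure is
needed. -/
theorem exists_fixed_point_of_bounded_orbits {E Γ : Type*} [NormedAddCommGroup E]
    [InnerProductSpace ℝ E] [FiniteDimensional ℝ E] [Group Γ] (ρ : Γ →* (E →ₗ[ℝ] E))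
    (hb : ∀ x, ∃ M : ℝ, ∀ g, ‖ρ g x‖ ≤ M) {C : Set E} (hne : C.Nonempty) (hconv : Convex ℝ C)
    (hcl : IsClosed C) (hinv : ∀ g, ∀ x ∈ C, ρ g x ∈ C) : ∃ x ∈ C, ∀ g, ρ g x = x := by
  have hcomplete : CompleteSpace E := FiniteDimensional.complete ℝ E
  obtain ⟨M₀, hM₀⟩ := banach_steinhaus (g := fun g => LinearMap.toContinuousLinearMap (ρ g)) hb
  obtain ⟨M, hMpos, hM⟩ : ∃ M : ℝ, 0 < M ∧ ∀ g x, ‖ρ g x‖ ≤ M * ‖x‖ :=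
    ⟨max M₀ 1, by positivity, fun g x =>
      (ContinuousLinearMap.le_of_opNorm_le _ ((hM₀ g).trans (le_max_left _ _)) x)⟩
  set Φ : E → ℝ := fun x => ⨆ g, ‖ρ g x‖ ^ 2 with hΦ
  have hbdd : ∀ x, BddAbove (Set.range fun g => ‖ρ g x‖ ^ 2) := by
    intro x
    refine ⟨(M * ‖x‖) ^ 2, ?_⟩
    rintro _ ⟨g, rfl⟩
    exact pow_le_pow_left₀ (norm_nonneg _) (hM g x) 2
  have hle : ∀ g x, ‖ρ g x‖ ^ 2 ≤ Φ x := fun g x => le_ciSup (hbdd x) g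
  have hlsc : LowerSemicontinuous Φ := by
    refine lowerSemicontinuous_ciSup hbdd fun g => Continuous.lowerSemicontinuous ?_
    have : Continuous (ρ g) := LinearMap.continuous_of_finiteDimensional _
    fun_prop
  have hnorm : ∀ x, ‖x‖ ^ 2 ≤ Φ x := by
    intro x
    simpa using hle 1 x
  obtain ⟨x₀, hx₀⟩ := hne
  -- Since `Φ` dominates the squared norm, points outside this ball have a larger value than `x₀`.
  have hK : IsCompact (C ∩ Metric.closedBall 0 (Real.sqrt (Φ x₀))) :=
    (isCompact_closedBall _ _).inter_left hcl
  have hx₀K : x₀ ∈ C ∩ Metric.closedBall 0 (Real.sqrt (Φ x₀)) :=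
    ⟨hx₀, by simpa using Real.le_sqrt_of_sq_le (hnorm x₀)⟩
  obtain ⟨x, hxK, hmin⟩ := LowerSemicontinuousOn.exists_isMinOn ⟨x₀, hx₀K⟩ hK
    (hlsc.lowerSemicontinuousOn _)
  have hminC : ∀ y ∈ C, Φ x ≤ Φ y := by
    intro y hy
    by_cases hyb : y ∈ Metric.closedBall (0 : E) (Real.sqrt (Φ x₀))
    · exact hmin ⟨hy, hyb⟩
    · have h1 : Real.sqrt (Φ x₀) < ‖y‖ := by simpa using hyb
      have h2 : Φ x₀ < ‖y‖ ^ 2 := (Real.sqrt_lt' ((Real.sqrt_nonneg _).trans_lt h1)).1 h1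
      have h3 : Φ x ≤ Φ x₀ := hmin hx₀K
      linarith [hnorm y]
  refine ⟨x, hxK.1, fun h => ?_⟩
  set y := ρ h x with hy
  have hΦy : ∀ g, ‖ρ g y‖ ^ 2 ≤ Φ x := by
    intro g
    have : ρ g y = ρ (g * h) x := by rw [map_mul]; rfl
    rw [this]
    exact hle _ _
  have hyC : y ∈ C := hinv h x hxK.1
  have hmC : (1 / 2 : ℝ) • x + (1 / 2 : ℝ) • y ∈ C :=
    hconv hxK.1 hyC (by norm_num) (by norm_num) (by norm_num)
  have key : Φ ((1 / 2 : ℝ) • x + (1 / 2 : ℝ) • y) ≤ Φ x - (‖x - y‖ / M) ^ 2 / 4 := by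
    refine ciSup_le fun g => ?_
    -- The bound for the inverse of `g` keeps `ρ g (x - y)` away from zero uniformly in `g`, so the
    -- gain from the parallelogram law survives the supremum.
    have h1 : ‖x - y‖ ≤ M * ‖ρ g (x - y)‖ := by
      have : x - y = ρ g⁻¹ (ρ g (x - y)) := by
        rw [← Module.End.mul_apply, ← map_mul]
        simp
      conv_lhs => rw [this]
      exact hM _ _
    have h2 : ‖x - y‖ / M ≤ ‖ρ g (x - y)‖ := by
      rw [div_le_iff₀ hMpos]
      linarith
    have h3 : (‖x - y‖ / M) ^ 2 ≤ ‖ρ g (x - y)‖ ^ 2 :=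
      pow_le_pow_left₀ (by positivity) h2 2
    have h4 := parallelogram_law_with_norm ℝ (ρ g x) (ρ g y)
    have h5 : ρ g ((1 / 2 : ℝ) • x + (1 / 2 : ℝ) • y) = (1 / 2 : ℝ) • (ρ g x + ρ g y) := by
      simp [smul_add]
    rw [h5, norm_smul, mul_pow]
    rw [map_sub] at h3
    have h6 := hle g x
    have h7 := hΦy g
    have h8 : ‖(1 / 2 : ℝ)‖ ^ 2 = 1 / 4 := by norm_num
    rw [h8]
    nlinarith
  have h9 := hminC _ hmC
  have h10 : (‖x - y‖ / M) ^ 2 ≤ 0 := by linarith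
  have h11 : ‖x - y‖ / M = 0 := by nlinarith [sq_nonneg (‖x - y‖ / M)]
  have h12 : ‖x - y‖ = 0 := by
    rcases div_eq_zero_iff.1 h11 with h | h
    · exact h
    · exact absurd h hMpos.ne'
  exact (sub_eq_zero.1 (norm_eq_zero.1 h12)).symm

theorem exists_fixed_point_of_compact_orbits {V Γ : Type*} [AddCommGroup V] [Module ℝ V]
    [FiniteDimensional ℝ V] [TopologicalSpace V] [IsTopologicalAddGroup V] [ContinuousSMul ℝ V]
    [T2Space V] [Group Γ] (ρ : Γ →* (V →ₗ[ℝ] V))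
    (hb : ∀ x, ∃ K, IsCompact K ∧ ∀ g, ρ g x ∈ K) {C : Set V} (hne : C.Nonempty)
    (hconv : Convex ℝ C) (hcl : IsClosed C) (hinv : ∀ g, ∀ x ∈ C, ρ g x ∈ C) :
    ∃ x ∈ C, ∀ g, ρ g x = x := by
  let L : V ≃L[ℝ] EuclideanSpace ℝ (Fin (Module.finrank ℝ V)) := toEuclidean
  let σ : Γ →* (EuclideanSpace ℝ (Fin (Module.finrank ℝ V)) →ₗ[ℝ]
      EuclideanSpace ℝ (Fin (Module.finrank ℝ V))) :=
    { toFun := fun g => L.toLinearEquiv.toLinearMap ∘ₗ ρ g ∘ₗ L.symm.toLinearEquiv.toLinearMap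
      map_one' := by ext x : 1; simp
      map_mul' := fun g h => by ext x : 1; simp }
  have hσ : ∀ g x, σ g x = L (ρ g (L.symm x)) := fun g x => rfl
  obtain ⟨x, hxC, hx⟩ := exists_fixed_point_of_bounded_orbits σ (C := L.symm ⁻¹' C) (by
      intro x
      obtain ⟨K, hK, hgK⟩ := hb (L.symm x)
      obtain ⟨M, hM⟩ := (hK.image L.continuous).isBounded.exists_norm_le
      exact ⟨M, fun g => hM _ ⟨_, hgK g, rfl⟩⟩)
    (by
      obtain ⟨x, hx⟩ := hne
      exact ⟨L x, by simpa using hx⟩)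
    (hconv.linear_preimage L.symm.toLinearEquiv.toLinearMap)
    (hcl.preimage L.symm.continuous)
    (by
      intro g x hx
      simpa [hσ] using hinv g _ hx)
  refine ⟨L.symm x, hxC, fun g => ?_⟩
  have := hx g
  rw [hσ] at this
  simpa using congrArg L.symm this

-- The cone of unnormalized states

namespace AbstractStateSpace

variable {A : Type*} [AddCommGroup A] [Module ℝ A] [TopologicalSpace A] (S : AbstractStateSpace A)

theorem mem_cone_of_mem {w : A} (hw : w ∈ S.Ω) : w ∈ S.cone :=
  ⟨1, zero_le_one, w, hw, (one_smul ℝ w).symm⟩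

theorem u_eq_one {w : A} (hw : w ∈ S.Ω) : S.u w = 1 :=
  (S.u_eq_one_iff w (S.mem_cone_of_mem hw)).2 hw

theorem mem_of_u_eq_one {w : A} (hw : w ∈ S.cone) (h : S.u w = 1) : w ∈ S.Ω :=
  (S.u_eq_one_iff w hw).1 h

theorem zero_mem_cone : (0 : A) ∈ S.cone := by
  obtain ⟨w, hw⟩ := S.nonempty
  exact ⟨0, le_rfl, w, hw, (zero_smul ℝ w).symm⟩

theorem smul_mem_cone {c : ℝ} (hc : 0 ≤ c) {x : A} (hx : x ∈ S.cone) : c • x ∈ S.cone := by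
  obtain ⟨a, ha, w, hw, rfl⟩ := hx
  exact ⟨c * a, mul_nonneg hc ha, w, hw, smul_smul c a w⟩

theorem add_mem_cone {x y : A} (hx : x ∈ S.cone) (hy : y ∈ S.cone) : x + y ∈ S.cone := by
  obtain ⟨a, ha, w, hw, rfl⟩ := hx
  obtain ⟨b, hb, v, hv, rfl⟩ := hy
  rcases (add_nonneg ha hb).eq_or_lt with h | h
  · have ha0 : a = 0 := by linarith
    have hb0 : b = 0 := by linarith
    simpa [ha0, hb0] using S.zero_mem_cone
  · refine ⟨a + b, h.le, (a / (a + b)) • w + (b / (a + b)) • v,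
      S.convex hw hv (by positivity) (by positivity) (by field_simp), ?_⟩
    rw [smul_add, smul_smul, smul_smul, mul_div_cancel₀ _ h.ne', mul_div_cancel₀ _ h.ne']

theorem sum_mem_cone {ι : Type*} (s : Finset ι) {x : ι → A} (hx : ∀ i ∈ s, x i ∈ S.cone) :
    ∑ i ∈ s, x i ∈ S.cone :=
  Finset.sum_induction x (· ∈ S.cone) (fun _ _ => S.add_mem_cone) S.zero_mem_cone hx

theorem exists_eq_u_smul {x : A} (hx : x ∈ S.cone) : ∃ w ∈ S.Ω, x = S.u x • w := by
  obtain ⟨a, ha, w, hw, rfl⟩ := hx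
  exact ⟨w, hw, by simp [S.u_eq_one hw]⟩

theorem u_nonneg {x : A} (hx : x ∈ S.cone) : 0 ≤ S.u x := by
  obtain ⟨a, ha, w, hw, rfl⟩ := hx
  simpa [S.u_eq_one hw] using ha

theorem span_states : Submodule.span ℝ S.Ω = ⊤ := by
  rw [eq_top_iff, ← S.generating, Submodule.span_le]
  rintro _ ⟨a, -, w, hw, rfl⟩
  exact Submodule.smul_mem _ _ (Submodule.subset_span hw)

theorem exists_eq_sub (x : A) : ∃ a ∈ S.cone, ∃ b ∈ S.cone, x = a - b := by
  have hx : x ∈ Submodule.span ℝ S.Ω := by rw [S.span_states]; trivial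
  induction hx using Submodule.span_induction with
  | mem w hw => exact ⟨w, S.mem_cone_of_mem hw, 0, S.zero_mem_cone, (sub_zero w).symm⟩
  | zero => exact ⟨0, S.zero_mem_cone, 0, S.zero_mem_cone, (sub_zero 0).symm⟩
  | add y z _ _ hy hz =>
    obtain ⟨a, ha, b, hb, rfl⟩ := hy
    obtain ⟨a', ha', b', hb', rfl⟩ := hz
    exact ⟨a + a', S.add_mem_cone ha ha', b + b', S.add_mem_cone hb hb', by abel⟩
  | smul t y _ hy =>
    obtain ⟨a, ha, b, hb, rfl⟩ := hy
    rcases le_total 0 t with ht | ht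
    · exact ⟨t • a, S.smul_mem_cone ht ha, t • b, S.smul_mem_cone ht hb, smul_sub t a b⟩
    · exact ⟨(-t) • b, S.smul_mem_cone (neg_nonneg.2 ht) hb, (-t) • a,
        S.smul_mem_cone (neg_nonneg.2 ht) ha, by module⟩

theorem functional_ext {e f : Module.Dual ℝ A} (h : ∀ w ∈ S.Ω, e w = f w) : e = f :=
  LinearMap.ext_on S.span_states h

theorem IsPure.mem {w : A} (hw : S.IsPure w) : w ∈ S.Ω := hw.1

theorem IsEffect.nonneg {e : Module.Dual ℝ A} (he : S.IsEffect e) {w : A} (hw : w ∈ S.cone) :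
    0 ≤ e w := he.1 w hw

theorem IsEffect.le_one {e : Module.Dual ℝ A} (he : S.IsEffect e) {w : A} (hw : w ∈ S.Ω) :
    e w ≤ 1 := (he.2 w (S.mem_cone_of_mem hw)).trans_eq (S.u_eq_one hw)

/-- A face contains every state that occurs with positive weight in one of its elements. -/
theorem mem_face_of_sub_smul_mem_cone {H : Set A} (hH : IsFace S.Ω H) {w y : A} (hw : w ∈ H)
    (hy : y ∈ S.Ω) {s : ℝ} (hs : 0 < s) (h : w - s • y ∈ S.cone) : y ∈ H := by
  have hwΩ := hH.2.2.1 hw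
  obtain ⟨z, hz, hwz⟩ := S.exists_eq_u_smul h
  have hu : S.u (w - s • y) = 1 - s := by
    simp [S.u_eq_one hwΩ, S.u_eq_one hy]
  rw [hu] at hwz
  have hs1 : s ≤ 1 := by
    have := S.u_nonneg h
    linarith
  have hw' : s • y + (1 - s) • z = w := by rw [← hwz]; abel
  rcases hs1.eq_or_lt with rfl | hlt
  · have : y = w := by simpa using hw'
    rwa [this]
  · exact (hH.2.2.2 y hy z hz s hs hlt (hw' ▸ hw)).1

end AbstractStateSpace

-- Reversible transformations, allowed effects and frames

namespace DynamicalStateSpace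

variable {A : Type*} [AddCommGroup A] [Module ℝ A] [TopologicalSpace A] (S : DynamicalStateSpace A)

theorem symm_mem {T : A ≃ₗ[ℝ] A} (hT : T ∈ S.G) : T.symm ∈ S.G := S.G.inv_mem hT

theorem map_mem_cone {T : A ≃ₗ[ℝ] A} (hT : T ∈ S.G) {x : A} (hx : x ∈ S.cone) : T x ∈ S.cone :=
  (S.G_isTransformation T hT).1 x hx

/-- Neither the transformation nor its inverse can increase the normalization. -/
theorem u_map {T : A ≃ₗ[ℝ] A} (hT : T ∈ S.G) (x : A) : S.u (T x) = S.u x := by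
  have h : S.u ∘ₗ (T : A →ₗ[ℝ] A) = S.u := by
    refine S.functional_ext fun w hw => le_antisymm ?_ ?_
    · exact (S.G_isTransformation T hT).2 w (S.mem_cone_of_mem hw)
    · have := (S.G_isTransformation T.symm (S.symm_mem hT)).2 (T w)
        (S.map_mem_cone hT (S.mem_cone_of_mem hw))
      simpa using this
  exact LinearMap.congr_fun h x

theorem map_mem {T : A ≃ₗ[ℝ] A} (hT : T ∈ S.G) {x : A} (hx : x ∈ S.Ω) : T x ∈ S.Ω :=
  S.mem_of_u_eq_one (S.map_mem_cone hT (S.mem_cone_of_mem hx)) ((S.u_map hT x).trans (S.u_eq_one hx))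

theorem map_isPure {T : A ≃ₗ[ℝ] A} (hT : T ∈ S.G) {x : A} (hx : S.IsPure x) : S.IsPure (T x) := by
  refine ⟨S.map_mem hT hx.1, fun y hy z hz h => ?_⟩
  have h' : x ∈ openSegment ℝ (T.symm y) (T.symm z) := by
    obtain ⟨a, b, ha, hb, hab, hxy⟩ := h
    refine ⟨a, b, ha, hb, hab, ?_⟩
    rw [← map_smul, ← map_smul, ← map_add, hxy, LinearEquiv.symm_apply_apply]
  have := hx.2 (S.map_mem (S.symm_mem hT) hy) (S.map_mem (S.symm_mem hT) hz) h'
  rw [← this, LinearEquiv.apply_symm_apply]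

theorem allowed_nonempty : S.allowed.Nonempty := by
  by_contra h
  rw [Set.not_nonempty_iff_eq_empty] at h
  have hu : S.u ∈ Submodule.span ℝ S.allowed := by rw [S.allowed_span]; trivial
  rw [h, Submodule.span_empty, Submodule.mem_bot] at hu
  obtain ⟨w, hw⟩ := S.nonempty
  have := S.u_eq_one hw
  simp [hu] at this

theorem u_mem_allowed : S.u ∈ S.allowed := by
  obtain ⟨e, he⟩ := S.allowed_nonempty
  have := S.allowed_add e he _ (S.allowed_compl e he) (fun w _ => by simp)
  simpa using this

theorem zero_mem_allowed : (0 : Module.Dual ℝ A) ∈ S.allowed := by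
  simpa using S.allowed_compl _ S.u_mem_allowed

theorem sum_mem_allowed {ι : Type*} (s : Finset ι) {e : ι → Module.Dual ℝ A}
    (he : ∀ i ∈ s, e i ∈ S.allowed) (h : S.FunctionalLE (∑ i ∈ s, e i) S.u) :
    ∑ i ∈ s, e i ∈ S.allowed := by
  classical
  induction s using Finset.induction_on with
  | empty => simpa using S.zero_mem_allowed
  | insert a s ha ih =>
    rw [Finset.sum_insert ha] at h ⊢
    refine S.allowed_add _ (he a (Finset.mem_insert_self a s)) _ (ih
      (fun i hi => he i (Finset.mem_insert_of_mem hi)) fun w hw => (le_trans ?_ (h w hw))) h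
    have := (S.allowed_isEffect _ (he a (Finset.mem_insert_self a s))).1 w hw
    simp only [LinearMap.zero_apply] at this
    simpa using this

variable {S} in
theorem PerfectlyDistinguishable.comp {n m : ℕ} {w : Fin n → A}
    (hw : S.PerfectlyDistinguishable w) (f : Fin m ↪ Fin n) :
    S.PerfectlyDistinguishable (w ∘ f) := by
  obtain ⟨hΩ, e, he, hle, hδ⟩ := hw
  refine ⟨fun k => hΩ _, e ∘ f, fun j => he _, fun x hx => le_trans ?_ (hle x hx), ?_⟩
  · have h0 : ∀ i, 0 ≤ e i x := fun i => (S.allowed_isEffect _ (he i)).1 x hx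
    have := Finset.sum_le_sum_of_subset_of_nonneg (s := Finset.univ.map f) (t := Finset.univ)
      (f := fun i => e i x) (Finset.subset_univ _) (fun i _ _ => h0 i)
    simpa using this
  · intro j k
    simp [hδ]

variable {S} in
theorem IsFrame.comp {n m : ℕ} {w : Fin n → A} (hw : S.IsFrame w) (f : Fin m ↪ Fin n) :
    S.IsFrame (w ∘ f) := ⟨hw.1.comp f, fun _ => hw.2 _⟩

variable {S} in
theorem IsFrame.map {n : ℕ} {w : Fin n → A} (hw : S.IsFrame w) {T : A ≃ₗ[ℝ] A} (hT : T ∈ S.G) :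
    S.IsFrame fun i => T (w i) := by
  obtain ⟨⟨hΩ, e, he, hle, hδ⟩, hp⟩ := hw
  refine ⟨⟨fun k => S.map_mem hT (hΩ k), fun j => e j ∘ₗ (T.symm : A →ₗ[ℝ] A),
    fun j => S.allowed_comp _ (he j) _ (S.symm_mem hT), fun x hx => ?_, ?_⟩,
    fun k => S.map_isPure hT (hp k)⟩
  · have := hle _ (S.map_mem_cone (S.symm_mem hT) hx)
    rw [S.u_map (S.symm_mem hT)] at this
    simpa using this
  · intro j k
    simp [hδ]

variable {S} in
theorem PerfectlyDistinguishable.linearIndependent {n : ℕ} {w : Fin n → A}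
    (hw : S.PerfectlyDistinguishable w) : LinearIndependent ℝ w := by
  obtain ⟨-, e, -, -, hδ⟩ := hw
  rw [Fintype.linearIndependent_iff]
  intro g hg i
  have := congrArg (e i) hg
  simpa [hδ] using this

theorem isFrame_singleton {w : A} (hw : S.IsPure w) : S.IsFrame (fun _ : Fin 1 => w) := by
  refine ⟨⟨fun _ => hw.1, fun _ => S.u, fun _ => S.u_mem_allowed, fun x _ => by simp, ?_⟩,
    fun _ => hw⟩
  intro j k
  simp [S.u_eq_one hw.1, Subsingleton.elim j k]

/-- Two pure states told apart by an allowed effect form a frame. -/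
theorem isFrame_pair {w v : A} (hw : S.IsPure w) (hv : S.IsPure v) {e : Module.Dual ℝ A}
    (he : e ∈ S.allowed) (hew : e w = 1) (hev : e v = 0) : S.IsFrame ![w, v] := by
  refine ⟨⟨?_, ![e, S.u - e], ?_, ?_, ?_⟩, ?_⟩
  · intro k
    fin_cases k
    exacts [hw.1, hv.1]
  · intro k
    fin_cases k
    exacts [he, S.allowed_compl e he]
  · intro x _
    simp
  · intro j k
    fin_cases j <;> fin_cases k <;> simp [hew, hev, S.u_eq_one hw.1, S.u_eq_one hv.1]
  · intro k
    fin_cases k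
    exacts [hw, hv]

end DynamicalStateSpace

-- Frames of maximal size, their common sum and spectral decompositions

namespace DynamicalStateSpace

variable {A : Type*} [AddCommGroup A] [Module ℝ A] [TopologicalSpace A] (S : DynamicalStateSpace A)

/-- The reversible transformations act linearly on the space of states. -/
def actionHom : S.G →* (A →ₗ[ℝ] A) where
  toFun T := (T : A ≃ₗ[ℝ] A)
  map_one' := rfl
  map_mul' _ _ := rfl

/-- `N` is the largest number of members of a frame. -/
def IsRank (N : ℕ) : Prop :=
  (∃ v : Fin N → A, S.IsFrame v) ∧ ∀ (m : ℕ) (v : Fin m → A), S.IsFrame v → m ≤ N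

theorem exists_isRank [FiniteDimensional ℝ A] : ∃ N, S.IsRank N := by
  have hne : {m | ∃ v : Fin m → A, S.IsFrame v}.Nonempty := by
    obtain ⟨w, hw⟩ := S.nonempty
    refine ⟨0, Fin.elim0, ⟨fun k => k.elim0, Fin.elim0, fun k => k.elim0, fun x hx => ?_,
      fun k => k.elim0⟩, fun k => k.elim0⟩
    simpa using S.u_nonneg hx
  have hbdd : BddAbove {m | ∃ v : Fin m → A, S.IsFrame v} := by
    refine ⟨Module.finrank ℝ A, ?_⟩
    rintro m ⟨v, hv⟩
    simpa using hv.1.linearIndependent.fintype_card_le_finrank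
  exact ⟨_, Nat.sSup_mem hne hbdd, fun m v hv => le_csSup hbdd ⟨v, hv⟩⟩

variable {S} {N : ℕ}

/-- Strong symmetry carries the first `n` members of some frame of size `N` onto `w`; the remaining
members come along. -/
theorem IsFrame.exists_extension (h2 : S.StrongSymmetry) (hN : S.IsRank N) {n : ℕ} {w : Fin n → A}
    (hw : S.IsFrame w) : ∃ v : Fin N → A, S.IsFrame v ∧ ∀ i, v (Fin.castLE (hN.2 n w hw) i) = w i := by
  obtain ⟨v, hv⟩ := hN.1
  obtain ⟨T, hT, hTv⟩ := h2 n _ w (hv.comp (Fin.castLEEmb (hN.2 n w hw))) hw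
  exact ⟨fun i => T (v i), hv.map hT, hTv⟩

theorem exists_frame_decomposition (h1 : S.ClassicalDecomposability) (h2 : S.StrongSymmetry)
    (hN : S.IsRank N) {w : A} (hw : w ∈ S.Ω) : ∃ (p : Fin N → ℝ) (v : Fin N → A),
      (∀ j, 0 ≤ p j) ∧ ∑ j, p j = 1 ∧ S.IsFrame v ∧ w = ∑ j, p j • v j := by
  obtain ⟨n, p, v, hp, hp1, hv, rfl⟩ := h1 w hw
  obtain ⟨v', hv', hvv⟩ := hv.exists_extension h2 hN
  have hinj := Fin.castLE_injective (hN.2 n v hv)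
  -- The members added by the extension get weight 0.
  refine ⟨Function.extend (Fin.castLE (hN.2 n v hv)) p 0, v', fun j => ?_, ?_, hv', ?_⟩
  · by_cases hj : ∃ i, Fin.castLE (hN.2 n v hv) i = j
    · obtain ⟨i, rfl⟩ := hj
      rw [hinj.extend_apply]
      exact hp i
    · rw [Function.extend_apply' _ _ _ hj]
      simp
  · rw [← hp1]
    refine (Fintype.sum_of_injective _ hinj _ _ (fun i hi => ?_) fun i => ?_).symm
    · exact Function.extend_apply' _ _ _ hi
    · rw [hinj.extend_apply]
  · refine Fintype.sum_of_injective _ hinj _ _ (fun i hi => ?_) fun i => ?_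
    · rw [Function.extend_apply' _ _ _ hi]
      simp
    · rw [hinj.extend_apply, hvv]

variable (S) in
theorem exists_compact_orbit [IsTopologicalAddGroup A] [ContinuousSMul ℝ A] (x : A) :
    ∃ K, IsCompact K ∧ ∀ g, S.actionHom g x ∈ K := by
  obtain ⟨a, ha, b, hb, rfl⟩ := S.exists_eq_sub x
  obtain ⟨w, hw, hwa⟩ := S.exists_eq_u_smul ha
  obtain ⟨v, hv, hvb⟩ := S.exists_eq_u_smul hb
  refine ⟨(fun q : A × A => S.u a • q.1 - S.u b • q.2) '' (S.Ω ×ˢ S.Ω),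
    (S.isCompact.prod S.isCompact).image (by fun_prop), fun g => ?_⟩
  refine ⟨((g : A ≃ₗ[ℝ] A) w, (g : A ≃ₗ[ℝ] A) v), ⟨S.map_mem g.2 hw, S.map_mem g.2 hv⟩, ?_⟩
  change _ = (g : A ≃ₗ[ℝ] A) (a - b)
  rw [hwa, hvb]
  simp [S.u_eq_one hw, S.u_eq_one hv]

section Center

variable [FiniteDimensional ℝ A] [IsTopologicalAddGroup A] [ContinuousSMul ℝ A] [T2Space A]

variable (S) in
theorem exists_invariant_state : ∃ μ ∈ S.Ω, ∀ T ∈ S.G, T μ = μ := by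
  obtain ⟨μ, hμ, h⟩ := exists_fixed_point_of_compact_orbits S.actionHom S.exists_compact_orbit
    S.nonempty S.convex S.isCompact.isClosed (fun g x hx => S.map_mem g.2 hx)
  exact ⟨μ, hμ, fun T hT => h ⟨T, hT⟩⟩

/-- All frames of maximal size have the same sum. -/
theorem exists_center (h1 : S.ClassicalDecomposability) (h2 : S.StrongSymmetry)
    (hN : S.IsRank N) : ∃ c : A, ∀ v : Fin N → A, S.IsFrame v → ∑ i, v i = c := by
  obtain ⟨μ, hμ, hGμ⟩ := S.exists_invariant_state
  obtain ⟨p, v, hp, hp1, hv, hμv⟩ := exists_frame_decomposition h1 h2 hN hμ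
  -- A reversible transformation transposes two members of the frame and fixes the others;
  -- invariance of `μ` and linear independence then equate the two weights.
  have hswap : ∀ i j, p i = p j := by
    intro i j
    obtain ⟨T, hT, hTv⟩ := h2 N v _ hv (hv.comp (Equiv.swap i j).toEmbedding)
    have h3 : ∑ k, p (Equiv.swap i j k) • v k = ∑ k, p k • v k := by
      rw [← hμv, ← hGμ T hT, hμv, map_sum, ← Equiv.sum_comp (Equiv.swap i j)]
      simp [hTv]
    have h4 : ∑ k, (p (Equiv.swap i j k) - p k) • v k = 0 := by
      simp only [sub_smul, Finset.sum_sub_distrib, h3, sub_self]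
    have h5 := Fintype.linearIndependent_iff.1 hv.1.linearIndependent _ h4 j
    rw [Equiv.swap_apply_right] at h5
    linarith
  have hsum : ∑ i, v i = (N : ℝ) • μ := by
    have h3 : ∀ i, (N : ℝ) * p i = 1 := by
      intro i
      rw [← hp1, Finset.sum_congr rfl fun j _ => hswap j i]
      simp
    rw [hμv, Finset.smul_sum]
    exact Finset.sum_congr rfl fun i _ => by rw [smul_smul, h3, one_smul]
  refine ⟨(N : ℝ) • μ, fun w hw => ?_⟩
  obtain ⟨T, hT, hTw⟩ := h2 N v w hv hw
  rw [← Finset.sum_congr rfl fun i _ => hTw i, ← map_sum, hsum, map_smul, hGμ T hT]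

end Center

/-- Every vector is a linear combination of the members of a maximal frame. -/
theorem exists_spectral_decomposition (h1 : S.ClassicalDecomposability) (h2 : S.StrongSymmetry)
    (hN : S.IsRank N) {c : A} (hc : ∀ v : Fin N → A, S.IsFrame v → ∑ i, v i = c) (x : A) :
    ∃ (a : Fin N → ℝ) (v : Fin N → A), S.IsFrame v ∧ x = ∑ j, a j • v j := by
  obtain ⟨y, hy, z, hz, rfl⟩ := S.exists_eq_sub x
  -- Weights of a state are at most 1, so `c` dominates every state. Adding a multiple of `c` thus
  -- moves `x` into the cone, and removing it again only shifts the coefficients, as `c` is the sum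
  -- of whichever frame occurs.
  have hdom : S.u z • c - z ∈ S.cone := by
    obtain ⟨w, hw, hwz⟩ := S.exists_eq_u_smul hz
    obtain ⟨p, v, hp, hp1, hv, rfl⟩ := exists_frame_decomposition h1 h2 hN hw
    have h3 : S.u z • c - z = S.u z • ∑ j, (1 - p j) • v j := by
      conv_lhs => rw [hwz, map_smul, S.u_eq_one hw, smul_eq_mul, mul_one, ← hc v hv]
      simp only [sub_smul, one_smul, Finset.sum_sub_distrib, smul_sub]
    rw [h3]
    refine S.smul_mem_cone (S.u_nonneg hz) (S.sum_mem_cone _ fun j _ => S.smul_mem_cone ?_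
      (S.mem_cone_of_mem (hv.2 j).1))
    have := Finset.single_le_sum (f := p) (fun i _ => hp i) (Finset.mem_univ j)
    linarith
  have hpos := S.add_mem_cone hy hdom
  set t := S.u z
  obtain ⟨w, hw, hw'⟩ := S.exists_eq_u_smul hpos
  obtain ⟨p, v, hp, hp1, hv, hpv⟩ := exists_frame_decomposition h1 h2 hN hw
  set s := S.u (y + (t • c - z))
  refine ⟨fun j => s * p j - t, v, hv, ?_⟩
  simp only [sub_smul, Finset.sum_sub_distrib, mul_smul, ← Finset.smul_sum, ← hpv, hc v hv, ← hw']
  abel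

end DynamicalStateSpace

-- An invariant inner product

namespace DynamicalStateSpace

variable {A : Type*} [AddCommGroup A] [Module ℝ A] [TopologicalSpace A] (S : DynamicalStateSpace A)

/-- The action of the reversible transformations on bilinear forms, in matrix coordinates. -/
noncomputable def formAction {ι : Type*} [Fintype ι] [DecidableEq ι] (b : Module.Basis ι ℝ A) :
    S.G →* (Matrix ι ι ℝ →ₗ[ℝ] Matrix ι ι ℝ) where
  toFun T :=
    { toFun := fun M => LinearMap.BilinForm.toMatrix b
        ((Matrix.toBilin b M).comp ((T⁻¹ : S.G) : A ≃ₗ[ℝ] A).toLinearMap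
          ((T⁻¹ : S.G) : A ≃ₗ[ℝ] A).toLinearMap)
      map_add' := fun M M' => by
        ext i j
        simp [LinearMap.BilinForm.toMatrix_apply]
      map_smul' := fun t M => by
        ext i j
        simp [LinearMap.BilinForm.toMatrix_apply] }
  map_one' := by
    ext M : 1
    simp
  map_mul' T T' := by
    ext M : 1
    simp only [LinearMap.coe_mk, AddHom.coe_mk, Module.End.mul_apply, Matrix.toBilin_toMatrix]
    congr 1

theorem toBilin_formAction {ι : Type*} [Fintype ι] [DecidableEq ι] (b : Module.Basis ι ℝ A)
    (T : S.G) (M : Matrix ι ι ℝ) (x y : A) :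
    Matrix.toBilin b (S.formAction b T M) x y =
      Matrix.toBilin b M ((T : A ≃ₗ[ℝ] A).symm x) ((T : A ≃ₗ[ℝ] A).symm y) := by
  simp only [formAction, MonoidHom.coe_mk, OneHom.coe_mk, LinearMap.coe_mk, AddHom.coe_mk,
    Matrix.toBilin_toMatrix]
  rfl

theorem eq_zero_of_allowed {x : A} [FiniteDimensional ℝ A] (hx : ∀ e ∈ S.allowed, e x = 0) :
    x = 0 := by
  rw [← Module.forall_dual_apply_eq_zero_iff ℝ x]
  intro e
  have he : e ∈ Submodule.span ℝ S.allowed := by rw [S.allowed_span]; trivial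
  induction he using Submodule.span_induction with
  | mem e he => exact hx e he
  | zero => rfl
  | add f g _ _ hf hg => simp [hf, hg]
  | smul t f _ hf => simp [hf]

theorem exists_invariant_form [FiniteDimensional ℝ A] [IsTopologicalAddGroup A]
    [ContinuousSMul ℝ A] [T2Space A] : ∃ B : LinearMap.BilinForm ℝ A,
      (∀ x y, B x y = B y x) ∧ (∀ x, x ≠ 0 → 0 < B x x) ∧
      ∀ T ∈ S.G, ∀ x y, B (T x) (T y) = B x y := by
  classical
  -- With a basis of states, effects take values in `[0, 1]` on the basis and its orbit stays in the
  -- compact set `Ω`.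
  obtain ⟨ι, _, b, hbΩ⟩ : ∃ (ι : Type _) (_ : Fintype ι) (b : Module.Basis ι ℝ A),
      ∀ i, b i ∈ S.Ω :=
    ⟨_, FiniteDimensional.fintypeBasisIndex (Module.Basis.ofSpan S.span_states.ge),
      Module.Basis.ofSpan S.span_states.ge,
      fun i => Module.Basis.ofSpan_subset S.span_states.ge ⟨i, rfl⟩⟩
  -- Domination of all `e ^ 2` is a closed, convex and invariant condition that still forces
  -- definiteness, because allowed effects separate points.
  let C : Set (Matrix ι ι ℝ) := {M | (∀ x y, Matrix.toBilin b M x y = Matrix.toBilin b M y x) ∧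
    ∀ e ∈ S.allowed, ∀ x, e x ^ 2 ≤ Matrix.toBilin b M x x}
  have hcont : ∀ x y, Continuous fun M => Matrix.toBilin b M x y := by
    intro x y
    simp only [Matrix.toBilin_apply]
    fun_prop
  have hCcl : IsClosed C := by
    simp only [C, Set.ofPred_and, Set.ofPred_forall]
    refine IsClosed.inter ?_ ?_
    · exact isClosed_iInter fun x => isClosed_iInter fun y => isClosed_eq (hcont x y) (hcont y x)
    · exact isClosed_iInter fun e => isClosed_iInter fun _ => isClosed_iInter fun x =>
        isClosed_le continuous_const (hcont x x)
  have hCconv : Convex ℝ C := by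
    intro M hM M' hM' s t hs ht hst
    refine ⟨fun x y => ?_, fun e he x => ?_⟩
    · simp [hM.1 x y, hM'.1 x y]
    · have h1 := mul_le_mul_of_nonneg_left (hM.2 e he x) hs
      have h2 := mul_le_mul_of_nonneg_left (hM'.2 e he x) ht
      have h3 : e x ^ 2 = s * e x ^ 2 + t * e x ^ 2 := by rw [← add_mul, hst, one_mul]
      simp only [map_add, map_smul, LinearMap.add_apply, LinearMap.smul_apply, smul_eq_mul]
      linarith
  have hCne : C.Nonempty := by
    -- The factor `card ι` is the Cauchy–Schwarz constant for the square of a sum over `ι`.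
    refine ⟨Matrix.diagonal fun _ => (Fintype.card ι : ℝ), fun x y => ?_, fun e he x => ?_⟩
    · simp only [Matrix.toBilin_apply, Matrix.diagonal_apply, mul_ite, ite_mul, mul_zero, zero_mul,
        Finset.sum_ite_eq, Finset.mem_univ, if_true]
      exact Finset.sum_congr rfl fun i _ => by ring
    · have h1 : e x = ∑ i, b.repr x i * e (b i) := by
        conv_lhs => rw [← b.sum_repr x]
        simp only [map_sum, map_smul, smul_eq_mul]
      have h2 : (∑ i, b.repr x i * e (b i)) ^ 2 ≤
          (Fintype.card ι : ℝ) * ∑ i, (b.repr x i * e (b i)) ^ 2 := by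
        simpa using sq_sum_le_card_mul_sum_sq (s := Finset.univ)
          (f := fun i => b.repr x i * e (b i))
      have h3 : ∀ i, (b.repr x i * e (b i)) ^ 2 ≤ (b.repr x i) ^ 2 := by
        intro i
        have h4 := (S.allowed_isEffect e he).nonneg _ (S.mem_cone_of_mem (hbΩ i))
        have h5 := (S.allowed_isEffect e he).le_one _ (hbΩ i)
        rw [mul_pow]
        exact mul_le_of_le_one_right (sq_nonneg _) (pow_le_one₀ h4 h5)
      simp only [Matrix.toBilin_apply, Matrix.diagonal_apply, mul_ite, ite_mul, mul_zero, zero_mul,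
        Finset.sum_ite_eq, Finset.mem_univ, if_true]
      rw [h1]
      refine h2.trans ?_
      rw [Finset.mul_sum]
      refine Finset.sum_le_sum fun i _ => ?_
      nlinarith [h3 i, Nat.cast_nonneg (α := ℝ) (Fintype.card ι)]
  have hbdd : ∀ M, ∃ K, IsCompact K ∧ ∀ T, S.formAction b T M ∈ K := by
    intro M
    have hrepr : ∀ i, Continuous fun x => b.repr x i := fun i =>
      LinearMap.continuous_of_finiteDimensional (b.coord i)
    have hf : Continuous fun q : A × A => Matrix.toBilin b M q.1 q.2 := by
      simp only [Matrix.toBilin_apply]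
      fun_prop
    let K₀ := (fun q : A × A => Matrix.toBilin b M q.1 q.2) '' (S.Ω ×ˢ S.Ω)
    have hK₀ : IsCompact K₀ := (S.isCompact.prod S.isCompact).image hf
    refine ⟨Set.pi Set.univ fun _ => Set.pi Set.univ fun _ => K₀,
      isCompact_univ_pi fun _ => isCompact_univ_pi fun _ => hK₀, fun T i _ j _ => ?_⟩
    refine ⟨((T : A ≃ₗ[ℝ] A).symm (b i), (T : A ≃ₗ[ℝ] A).symm (b j)),
      ⟨S.map_mem (S.symm_mem T.2) (hbΩ i), S.map_mem (S.symm_mem T.2) (hbΩ j)⟩, ?_⟩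
    rw [← LinearMap.BilinForm.toMatrix_toBilin b (S.formAction b T M),
      LinearMap.BilinForm.toMatrix_apply, toBilin_formAction]
  have hinv : ∀ T, ∀ M ∈ C, S.formAction b T M ∈ C := by
    intro T M hM
    refine ⟨fun x y => ?_, fun e he x => ?_⟩
    · rw [toBilin_formAction, toBilin_formAction, hM.1]
    · rw [toBilin_formAction]
      simpa using hM.2 _ (S.allowed_comp e he _ T.2) ((T : A ≃ₗ[ℝ] A).symm x)
  obtain ⟨M, hMC, hM⟩ := exists_fixed_point_of_compact_orbits (S.formAction b) hbdd hCne hCconv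
    hCcl hinv
  refine ⟨Matrix.toBilin b M, hMC.1, fun x hx => ?_, fun T hT x y => ?_⟩
  · by_contra h
    refine hx (S.eq_zero_of_allowed fun e he => ?_)
    have := hMC.2 e he x
    nlinarith
  · rw [← hM ⟨T, hT⟩, toBilin_formAction, hM]
    simp

end DynamicalStateSpace

-- The form with orthonormal frames, and self-duality

namespace DynamicalStateSpace

variable {A : Type*} [AddCommGroup A] [Module ℝ A] [TopologicalSpace A] (S : DynamicalStateSpace A)

/-- `B` is an invariant form for which the maximal frames, all of which have the sum `c`, are
orthonormal; the maximal frames decompose all vectors, and contain all frames. -/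
structure IsFrameForm (N : ℕ) (B : LinearMap.BilinForm ℝ A) (c : A) : Prop where
  symm : ∀ x y, B x y = B y x
  invariant : ∀ T ∈ S.G, ∀ x y, B (T x) (T y) = B x y
  apply_frame : ∀ v : Fin N → A, S.IsFrame v → ∀ i j, B (v i) (v j) = if i = j then 1 else 0
  sum_frame : ∀ v : Fin N → A, S.IsFrame v → ∑ i, v i = c
  card_le : ∀ (n : ℕ) (w : Fin n → A), S.IsFrame w → n ≤ N
  extension : ∀ (n : ℕ) (w : Fin n → A) (hw : S.IsFrame w),
    ∃ v : Fin N → A, S.IsFrame v ∧ ∀ i, v (Fin.castLE (card_le n w hw) i) = w i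
  spectral : ∀ x, ∃ (a : Fin N → ℝ) (v : Fin N → A), S.IsFrame v ∧ x = ∑ j, a j • v j
  decomposition : ∀ w ∈ S.Ω, ∃ (p : Fin N → ℝ) (v : Fin N → A),
      (∀ j, 0 ≤ p j) ∧ ∑ j, p j = 1 ∧ S.IsFrame v ∧ w = ∑ j, p j • v j

theorem exists_isFrameForm [FiniteDimensional ℝ A] [IsTopologicalAddGroup A]
    [ContinuousSMul ℝ A] [T2Space A] (h1 : S.ClassicalDecomposability) (h2 : S.StrongSymmetry) :
    ∃ N B c, S.IsFrameForm N B c := by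
  obtain ⟨N, hN⟩ := S.exists_isRank
  obtain ⟨c, hc⟩ := exists_center h1 h2 hN
  obtain ⟨B₀, hsymm, hpos, hinv⟩ := S.exists_invariant_form
  obtain ⟨α, hα⟩ : ∃ α, ∀ x, S.IsPure x → B₀ x x = α := by
    by_cases h : ∃ x, S.IsPure x
    · obtain ⟨x, hx⟩ := h
      refine ⟨B₀ x x, fun y hy => ?_⟩
      obtain ⟨T, hT, hTx⟩ := h2 1 _ _ (S.isFrame_singleton hx) (S.isFrame_singleton hy)
      rw [← hTx 0, hinv T hT]
    · exact ⟨0, fun x hx => absurd ⟨x, hx⟩ h⟩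
  obtain ⟨β, hβα, hβ⟩ : ∃ β < α, ∀ x : Fin 2 → A, S.IsFrame x → B₀ (x 0) (x 1) = β := by
    by_cases h : ∃ x : Fin 2 → A, S.IsFrame x
    · obtain ⟨x, hx⟩ := h
      refine ⟨B₀ (x 0) (x 1), ?_, fun y hy => ?_⟩
      · have hne : x 0 - x 1 ≠ 0 :=
          sub_ne_zero.2 (hx.1.linearIndependent.injective.ne (by decide))
        have := hpos _ hne
        simp only [map_sub, LinearMap.sub_apply, hα _ (hx.2 0), hα _ (hx.2 1),
          hsymm (x 1) (x 0)] at this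
        linarith
      · obtain ⟨T, hT, hTx⟩ := h2 2 _ _ hx hy
        rw [← hTx 0, ← hTx 1, hinv T hT]
    -- Without frames of size two any value below `α` serves.
    · exact ⟨α - 1, by linarith, fun x hx => absurd ⟨x, hx⟩ h⟩
  have hne : α - β ≠ 0 := by linarith
  -- As `u` is 1 on states, the subtraction turns the values `β` and `α` into `0` and `α - β`.
  refine ⟨N, (α - β)⁻¹ • (B₀ - β • LinearMap.BilinForm.linMulLin S.u S.u), c, ?_, ?_, ?_, hc, hN.2,
    fun n w hw => hw.exists_extension h2 hN, exists_spectral_decomposition h1 h2 hN hc,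
    fun w hw => exists_frame_decomposition h1 h2 hN hw⟩
  · intro x y
    simp [hsymm x y, mul_comm (S.u x)]
  · intro T hT x y
    simp [hinv T hT, S.u_map hT]
  · intro v hv i j
    simp only [LinearMap.smul_apply, LinearMap.sub_apply, LinearMap.BilinForm.linMulLin_apply,
      S.u_eq_one (hv.2 i).1, S.u_eq_one (hv.2 j).1, smul_eq_mul, mul_one]
    split_ifs with h
    · subst h
      rw [hα _ (hv.2 i), inv_mul_cancel₀ hne]
    · have : B₀ (v i) (v j) = β := hβ _ (hv.comp ⟨![i, j], by
        intro a b
        fin_cases a <;> fin_cases b <;> simp [h, Ne.symm h]⟩)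
      rw [this, sub_self, mul_zero]

namespace IsFrameForm

variable {S} {N : ℕ} {B : LinearMap.BilinForm ℝ A} {c : A} (hB : S.IsFrameForm N B c)
include hB

theorem apply_sum_smul {v : Fin N → A} (hv : S.IsFrame v) (a : Fin N → ℝ) (i : Fin N) :
    B (∑ j, a j • v j) (v i) = a i := by
  simp [hB.apply_frame v hv]

theorem apply_self_sum_smul {v : Fin N → A} (hv : S.IsFrame v) (a : Fin N → ℝ) :
    B (∑ j, a j • v j) (∑ j, a j • v j) = ∑ j, a j ^ 2 := by
  rw [map_sum]
  refine Finset.sum_congr rfl fun i _ => ?_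
  rw [map_smul, hB.apply_sum_smul hv, smul_eq_mul, sq]

/-- Definiteness is not visible after the subtraction of `β u ⊗ u`; it comes back from spectral
decompositions, where `B x x` is a sum of squares. -/
theorem pos {x : A} (hx : x ≠ 0) : 0 < B x x := by
  obtain ⟨a, v, hv, rfl⟩ := hB.spectral x
  rw [hB.apply_self_sum_smul hv]
  refine lt_of_le_of_ne (Finset.sum_nonneg fun i _ => sq_nonneg _) fun h => hx ?_
  have := (Finset.sum_eq_zero_iff_of_nonneg fun i _ => sq_nonneg (a i)).1 h.symm
  refine Finset.sum_eq_zero fun i hi => ?_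
  rw [pow_eq_zero_iff two_ne_zero |>.1 (this i hi), zero_smul]

theorem eq_zero {x : A} (hx : B x x = 0) : x = 0 := by
  by_contra h
  exact (hB.pos h).ne' hx

/-- In the frame that diagonalizes `x`, both sides are the sum of the coefficients. -/
theorem apply_center (x : A) : B x c = S.u x := by
  obtain ⟨a, v, hv, rfl⟩ := hB.spectral x
  rw [← hB.sum_frame v hv, map_sum, Finset.sum_congr rfl fun i _ => hB.apply_sum_smul hv a i]
  simp [S.u_eq_one (hv.2 _).1]

theorem exists_dual [FiniteDimensional ℝ A] (e : Module.Dual ℝ A) : ∃ a, ∀ x, e x = B x a := by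
  have hker : LinearMap.ker B = ⊥ := by
    rw [LinearMap.ker_eq_bot']
    intro x hx
    exact hB.eq_zero (by rw [hx]; rfl)
  have hsurj : Function.Surjective B :=
    (LinearMap.injective_iff_surjective_of_finrank_eq_finrank
      (Subspace.dual_finrank_eq (K := ℝ) (V := A)).symm).1 (LinearMap.ker_eq_bot.1 hker)
  obtain ⟨a, rfl⟩ := hsurj e
  exact ⟨a, fun x => hB.symm a x⟩

/-- The spectral coefficients of `a` are its products with pure states. This is the harder half of
self-duality. -/
theorem mem_cone_of_nonneg {a : A} (ha : ∀ w, S.IsPure w → 0 ≤ B w a) : a ∈ S.cone := by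
  obtain ⟨t, v, hv, rfl⟩ := hB.spectral a
  refine S.sum_mem_cone _ fun i _ => S.smul_mem_cone ?_ (S.mem_cone_of_mem (hv.2 i).1)
  rw [← hB.apply_sum_smul hv t i, hB.symm]
  exact ha _ (hv.2 i)

theorem exists_frame_of_isPure {w : A} (hw : S.IsPure w) :
    ∃ v : Fin N → A, S.IsFrame v ∧ ∃ i, v i = w := by
  obtain ⟨v, hv, hvw⟩ := hB.extension 1 _ (S.isFrame_singleton hw)
  exact ⟨v, hv, _, hvw 0⟩

theorem apply_self {w : A} (hw : S.IsPure w) : B w w = 1 := by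
  obtain ⟨v, hv, i, rfl⟩ := hB.exists_frame_of_isPure hw
  simp [hB.apply_frame v hv]

/-- The effect that tells a pure state apart from the rest of a maximal frame is represented by
this state. -/
theorem flip_mem_allowed [FiniteDimensional ℝ A] {w : A} (hw : S.IsPure w) : B w ∈ S.allowed := by
  obtain ⟨v, hv, k, rfl⟩ := hB.exists_frame_of_isPure hw
  obtain ⟨⟨hΩ, e, he, hle, hδ⟩, hp⟩ := id hv
  obtain ⟨a, ha⟩ := hB.exists_dual (e k)
  have hec : e k c = 1 := by
    rw [← hB.sum_frame v hv, map_sum]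
    simp [hδ]
  -- The spectral coefficients of `a` are values of the effect `e k` on pure states, so they lie in
  -- `[0, 1]`; they sum to `e k c = 1`. Hence their squares sum to at most 1.
  have haa : B a a ≤ 1 := by
    obtain ⟨t, w, hw, rfl⟩ := hB.spectral a
    have ht : ∀ i, e k (w i) = t i := fun i => by
      rw [ha, hB.symm, hB.apply_sum_smul hw]
    have hsum : ∑ i, t i = 1 := by
      rw [← hec, ← hB.sum_frame w hw, map_sum]
      exact Finset.sum_congr rfl fun i _ => (ht i).symm
    rw [hB.apply_self_sum_smul hw, ← hsum]
    refine Finset.sum_le_sum fun i _ => ?_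
    have h0 := (S.allowed_isEffect _ (he k)).nonneg _ (S.mem_cone_of_mem (hw.2 i).1)
    have h1 := (S.allowed_isEffect _ (he k)).le_one _ (hw.2 i).1
    rw [ht] at h0 h1
    nlinarith
  have hva : B (v k) a = 1 := by rw [← ha, hδ, if_pos rfl]
  -- Equality case of Cauchy–Schwarz: `B (v k) a = 1`, while neither vector has norm above 1.
  have h : a - v k = 0 := by
    by_contra h
    have := hB.pos h
    simp only [map_sub, LinearMap.sub_apply, hB.symm a (v k), hva, hB.apply_self hw] at this
    linarith
  have : B (v k) = e k := by
    ext x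
    rw [ha, sub_eq_zero.1 h, hB.symm]
  rw [this]
  exact he k

variable [FiniteDimensional ℝ A]

theorem apply_mem_nonneg {w v : A} (hw : w ∈ S.Ω) (hv : v ∈ S.Ω) : 0 ≤ B w v := by
  obtain ⟨p, x, hp, -, hx, rfl⟩ := hB.decomposition w hw
  simp only [map_sum, map_smul, LinearMap.sum_apply, LinearMap.smul_apply, smul_eq_mul]
  exact Finset.sum_nonneg fun i _ => mul_nonneg (hp i)
    ((S.allowed_isEffect _ (hB.flip_mem_allowed (hx.2 i))).nonneg _ (S.mem_cone_of_mem hv))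

theorem nonneg {x y : A} (hx : x ∈ S.cone) (hy : y ∈ S.cone) : 0 ≤ B x y := by
  obtain ⟨a, ha, w, hw, rfl⟩ := hx
  obtain ⟨b, hb, v, hv, rfl⟩ := hy
  simpa using mul_nonneg hb (mul_nonneg ha (hB.apply_mem_nonneg hw hv))

theorem apply_pure_le_u {w x : A} (hw : S.IsPure w) (hx : x ∈ S.cone) : B w x ≤ S.u x :=
  (S.allowed_isEffect _ (hB.flip_mem_allowed hw)).2 x hx

theorem isSelfDualizing : S.IsSelfDualizing B where
  symm := hB.symm
  pos x hx := hB.pos hx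
  selfDual e := by
    constructor
    · intro he
      obtain ⟨a, ha⟩ := hB.exists_dual e
      refine ⟨a, hB.mem_cone_of_nonneg fun w hw => ?_, ha⟩
      rw [← ha]
      exact he w (S.mem_cone_of_mem hw.1)
    · rintro ⟨w, hw, he⟩ x hx
      rw [he]
      exact hB.nonneg hx hw
  invariant := hB.invariant
  mem_Icc w hw v hv := by
    refine ⟨hB.apply_mem_nonneg hw hv, ?_⟩
    obtain ⟨p, x, hp, hp1, hx, rfl⟩ := hB.decomposition w hw
    simp only [map_sum, map_smul, LinearMap.sum_apply, LinearMap.smul_apply, smul_eq_mul]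
    rw [← hp1]
    refine Finset.sum_le_sum fun i _ => mul_le_of_le_one_right (hp i) ?_
    exact (hB.apply_pure_le_u (hx.2 i) (S.mem_cone_of_mem hv)).trans_eq (S.u_eq_one hv)
  pure w hw := hB.apply_self hw
  -- For a mixed state some weight lies strictly between 0 and 1, so the squares of the weights sum
  -- to less than the weights.
  mixed w hw hnp := by
    obtain ⟨p, x, hp, hp1, hx, rfl⟩ := hB.decomposition w hw
    have hle : ∀ i, p i ≤ 1 := fun i =>
      hp1 ▸ Finset.single_le_sum (f := p) (fun i _ => hp i) (Finset.mem_univ i)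
    obtain ⟨k, -, hk⟩ : ∃ k ∈ Finset.univ, 0 < p k :=
      Finset.exists_lt_of_sum_lt (f := fun _ => (0 : ℝ)) (by simp [hp1])
    have hk1 : p k < 1 := by
      refine lt_of_le_of_ne (hle k) fun h => hnp ?_
      have h0 : ∀ j, j ≠ k → p j = 0 := by
        intro j hj
        have := Finset.add_le_sum (f := p) (s := Finset.univ) (fun i _ => hp i)
          (Finset.mem_univ j) (Finset.mem_univ k) hj
        linarith [hp j]
      rw [Finset.sum_eq_single k (fun j _ hj => by rw [h0 j hj, zero_smul]) (by simp), h, one_smul]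
      exact hx.2 k
    rw [hB.apply_self_sum_smul hx, ← hp1]
    refine Finset.sum_lt_sum (fun i _ => ?_) ⟨k, Finset.mem_univ k, ?_⟩
    · nlinarith [hp i, hle i]
    · nlinarith
  -- The distinguishing effect is 1 on every pure component of `w` and 0 on every one of `v`, so any
  -- two such components form a frame.
  orthogonal w v h := by
    obtain ⟨hΩ, e, he, -, hδ⟩ := h
    have hw := hΩ 0
    have hv := hΩ 1
    have hew := hδ 0 0
    have hev := hδ 0 1
    simp only [Matrix.cons_val_zero, Matrix.cons_val_one, if_true, Fin.zero_eq_one_iff]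
      at hw hv hew hev
    have heff := S.allowed_isEffect _ (he 0)
    obtain ⟨p, x, hp, hp1, hx, rfl⟩ := hB.decomposition w hw
    obtain ⟨q, y, hq, hq1, hy, rfl⟩ := hB.decomposition v hv
    simp only [map_sum, map_smul, smul_eq_mul] at hew hev
    have h1 : ∀ i, p i * (1 - e 0 (x i)) = 0 := by
      have : ∑ i, p i * (1 - e 0 (x i)) = 0 := by
        simp only [mul_sub, mul_one, Finset.sum_sub_distrib, hew, hp1, sub_self]
      intro i
      exact (Finset.sum_eq_zero_iff_of_nonneg fun i _ => mul_nonneg (hp i)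
        (sub_nonneg.2 (heff.le_one _ (hx.2 i).1))).1 this i (Finset.mem_univ i)
    have h2 : ∀ i, q i * e 0 (y i) = 0 := fun i =>
      (Finset.sum_eq_zero_iff_of_nonneg fun i _ => mul_nonneg (hq i)
        (heff.nonneg _ (S.mem_cone_of_mem (hy.2 i).1))).1 hev i (Finset.mem_univ i)
    simp only [map_sum, map_smul, LinearMap.sum_apply, LinearMap.smul_apply, smul_eq_mul,
      Finset.mul_sum]
    refine Finset.sum_eq_zero fun j _ => Finset.sum_eq_zero fun i _ => ?_
    rcases mul_eq_zero.1 (h1 i) with hi | hi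
    · simp [hi]
    rcases mul_eq_zero.1 (h2 j) with hj | hj
    · simp [hj]
    have hframe := S.isFrame_pair (hx.2 i) (hy.2 j) (he 0) (by linarith) hj
    obtain ⟨z, hz, hzw⟩ := hB.extension 2 _ hframe
    have h3 := hB.apply_frame z hz (Fin.castLE (hB.card_le 2 _ hframe) 0)
      (Fin.castLE (hB.card_le 2 _ hframe) 1)
    rw [hzw, hzw] at h3
    simp only [Matrix.cons_val_zero, Matrix.cons_val_one, Fin.castLE_inj, Fin.zero_eq_one_iff,
      OfNat.ofNat_ne_one, if_false] at h3
    rw [h3, mul_zero, mul_zero]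

end IsFrameForm

end DynamicalStateSpace

-- Orthogonal projections for a definite form

theorem exists_isOrthogonalProjection {A : Type*} [AddCommGroup A] [Module ℝ A]
    [FiniteDimensional ℝ A] {B : LinearMap.BilinForm ℝ A} (hsymm : ∀ x y, B x y = B y x)
    (hpos : ∀ x, x ≠ 0 → 0 < B x x) (V : Submodule ℝ A) :
    ∃ P : A →ₗ[ℝ] A, IsOrthogonalProjection B P V := by
  have hrefl : B.IsRefl := fun x y h => (hsymm y x).trans h
  have hcompl : IsCompl V (B.orthogonal V) := by
    rw [LinearMap.BilinForm.isCompl_orthogonal_iff_disjoint hrefl, Submodule.disjoint_def]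
    intro x hx hx'
    by_contra h
    exact (hpos x h).ne' (hx' x hx)
  have horth : ∀ x ∈ V, ∀ y ∈ B.orthogonal V, B x y = 0 := fun x hx y hy => hy x hx
  let p := V.projectionOnto _ hcompl
  have hfix : ∀ x : V, p x = x := V.projectionOnto_apply_left hcompl
  have hker : ∀ x, x - p x ∈ B.orthogonal V := by
    intro x
    rw [← Submodule.ker_projectionOnto hcompl, LinearMap.mem_ker]
    change p (x - p x) = 0
    rw [map_sub, hfix, sub_self]
  refine ⟨V.subtype ∘ₗ p, ?_, ?_, ?_⟩
  · ext x
    simp [hfix]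
  · rw [LinearMap.range_comp, LinearMap.range_eq_top.2 fun y : V => (⟨y, hfix y⟩ : ∃ x, p x = y)]
    simp
  · intro x y
    have h1 := horth (p x) (p x).2 _ (hker y)
    have h2 := horth (p y) (p y).2 _ (hker x)
    rw [map_sub] at h1 h2
    rw [hsymm (p y) x, hsymm (p y) (p x)] at h2
    change B (p x) y = B x (p y)
    linarith

namespace IsOrthogonalProjection

variable {A : Type*} [AddCommGroup A] [Module ℝ A] {B : LinearMap.BilinForm ℝ A} {P : A →ₗ[ℝ] A}
  {V : Submodule ℝ A}

theorem apply_mem (hP : IsOrthogonalProjection B P V) (x : A) : P x ∈ V :=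
  hP.2.1 ▸ LinearMap.mem_range_self P x

theorem apply_of_mem (hP : IsOrthogonalProjection B P V) {x : A} (hx : x ∈ V) : P x = x := by
  rw [← hP.2.1] at hx
  obtain ⟨y, rfl⟩ := hx
  exact LinearMap.congr_fun hP.1 y

theorem apply_eq_zero (hP : IsOrthogonalProjection B P V) (hpos : ∀ x, x ≠ 0 → 0 < B x x) {x : A}
    (hx : ∀ y ∈ V, B x y = 0) : P x = 0 := by
  by_contra h
  have h1 : B (P x) (P x) = B x (P x) := by
    rw [hP.2.2, hP.apply_of_mem (hP.apply_mem x)]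
  exact (hpos _ h).ne' (h1.trans (hx _ (hP.apply_mem x)))

end IsOrthogonalProjection

-- Orthogonal families of pure states and the faces they cut out

namespace DynamicalStateSpace

variable {A : Type*} [AddCommGroup A] [Module ℝ A] [TopologicalSpace A] (S : DynamicalStateSpace A)

/-- A family of mutually orthogonal pure states. -/
def IsOrthoPure (B : LinearMap.BilinForm ℝ A) {ι : Type*} (x : ι → A) : Prop :=
  (∀ i, S.IsPure (x i)) ∧ ∀ i j, i ≠ j → B (x i) (x j) = 0

/-- `d` is a sum of mutually orthogonal pure states. -/
def IsProjectionUnit (B : LinearMap.BilinForm ℝ A) (d : A) : Prop :=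
  ∃ (m : ℕ) (x : Fin m → A), S.IsOrthoPure B x ∧ ∑ i, x i = d

/-- The face of the cone on which the functional `B d` coincides with the order unit. -/
def faceCone (B : LinearMap.BilinForm ℝ A) (d : A) : Set A :=
  {y | y ∈ S.cone ∧ B d y = S.u y}

variable {S} {N : ℕ} {B : LinearMap.BilinForm ℝ A} {c d : A}

theorem IsOrthoPure.comp {ι κ : Type*} {x : ι → A} (hx : S.IsOrthoPure B x) {f : κ → ι}
    (hf : Function.Injective f) : S.IsOrthoPure B (x ∘ f) :=
  ⟨fun i => hx.1 (f i), fun _ _ h => hx.2 _ _ (hf.ne h)⟩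

theorem IsOrthoPure.isProjectionUnit {ι : Type*} [Fintype ι] {x : ι → A}
    (hx : S.IsOrthoPure B x) : S.IsProjectionUnit B (∑ i, x i) :=
  ⟨Fintype.card ι, x ∘ (Fintype.equivFin ι).symm, hx.comp (Equiv.injective _),
    Equiv.sum_comp (Fintype.equivFin ι).symm x⟩

theorem IsPure.isProjectionUnit {v : A} (hv : S.IsPure v) : S.IsProjectionUnit B v :=
  ⟨1, fun _ => v, ⟨fun _ => hv, fun _ _ h => absurd (Subsingleton.elim _ _) h⟩, by simp⟩

theorem faceCone_zero_mem : (0 : A) ∈ S.faceCone B d := ⟨S.zero_mem_cone, by simp⟩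

theorem faceCone_add_mem {x y : A} (hx : x ∈ S.faceCone B d) (hy : y ∈ S.faceCone B d) :
    x + y ∈ S.faceCone B d := ⟨S.add_mem_cone hx.1 hy.1, by simp [hx.2, hy.2]⟩

theorem faceCone_smul_mem {t : ℝ} (ht : 0 ≤ t) {x : A} (hx : x ∈ S.faceCone B d) :
    t • x ∈ S.faceCone B d := ⟨S.smul_mem_cone ht hx.1, by simp [hx.2]⟩

theorem faceCone_sum_mem {ι : Type*} (s : Finset ι) {x : ι → A}
    (hx : ∀ i ∈ s, x i ∈ S.faceCone B d) : ∑ i ∈ s, x i ∈ S.faceCone B d :=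
  Finset.sum_induction x (· ∈ S.faceCone B d) (fun _ _ => faceCone_add_mem) faceCone_zero_mem hx

theorem faceCone_exists_eq_sub {x : A} (hx : x ∈ Submodule.span ℝ (S.faceCone B d)) :
    ∃ a ∈ S.faceCone B d, ∃ b ∈ S.faceCone B d, x = a - b := by
  induction hx using Submodule.span_induction with
  | mem w hw => exact ⟨w, hw, 0, faceCone_zero_mem, (sub_zero w).symm⟩
  | zero => exact ⟨0, faceCone_zero_mem, 0, faceCone_zero_mem, (sub_zero 0).symm⟩
  | add y z _ _ hy hz =>
    obtain ⟨a, ha, b, hb, rfl⟩ := hy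
    obtain ⟨a', ha', b', hb', rfl⟩ := hz
    exact ⟨a + a', faceCone_add_mem ha ha', b + b', faceCone_add_mem hb hb', by abel⟩
  | smul t y _ hy =>
    obtain ⟨a, ha, b, hb, rfl⟩ := hy
    rcases le_total 0 t with ht | ht
    · exact ⟨t • a, faceCone_smul_mem ht ha, t • b, faceCone_smul_mem ht hb, smul_sub t a b⟩
    · exact ⟨(-t) • b, faceCone_smul_mem (neg_nonneg.2 ht) hb, (-t) • a,
        faceCone_smul_mem (neg_nonneg.2 ht) ha, by module⟩

variable [FiniteDimensional ℝ A]

namespace IsFrameForm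

variable (hB : S.IsFrameForm N B c)
include hB

/-- For an extension to size `N` the sum is `B c = u`, and the omitted terms are nonnegative on the
cone. -/
theorem sum_frame_le {n : ℕ} {w : Fin n → A} (hw : S.IsFrame w) :
    S.FunctionalLE (∑ j, B (w j)) S.u := by
  obtain ⟨v, hv, hvw⟩ := hB.extension n w hw
  intro x hx
  rw [← hB.apply_center, ← hB.sum_frame v hv, hB.symm]
  have := Finset.sum_le_sum_of_subset_of_nonneg
    (s := Finset.univ.map (Fin.castLEEmb (hB.card_le n w hw))) (t := Finset.univ)
    (f := fun i => B (v i) x) (Finset.subset_univ _)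
    (fun i _ _ => hB.nonneg (S.mem_cone_of_mem (hv.2 i).1) hx)
  simpa [hvw] using this

/-- The bound by `u` is known only for frames, hence the induction: it makes the sum of the first
`n` effects allowed, and the complement of that sum detects the last state. -/
theorem isFrame_of_isOrthoPure {n : ℕ} {x : Fin n → A} (hx : S.IsOrthoPure B x) :
    S.IsFrame x := by
  induction n with
  | zero =>
    exact ⟨⟨fun k => k.elim0, Fin.elim0, fun k => k.elim0,
      fun y hy => by simpa using S.u_nonneg hy, fun k => k.elim0⟩, fun k => k.elim0⟩
  | succ n ih =>
    have hx' := ih (hx.comp (Fin.castSucc_injective n))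
    have hle := hB.sum_frame_le hx'
    have hallow : ∑ j, B ((x ∘ Fin.castSucc) j) ∈ S.allowed :=
      S.sum_mem_allowed _ (fun j _ => hB.flip_mem_allowed (hx'.2 j)) hle
    refine ⟨⟨fun k => (hx.1 k).1, Fin.snoc (α := fun _ => Module.Dual ℝ A)
      (fun j => B (x j.castSucc)) (S.u - ∑ j, B ((x ∘ Fin.castSucc) j)), ?_, ?_, ?_⟩, hx.1⟩
    · intro j
      refine Fin.lastCases ?_ (fun j => ?_) j
      · simpa using S.allowed_compl _ hallow
      · simpa using hB.flip_mem_allowed (hx.1 _)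
    · intro y _
      simp [Fin.sum_univ_castSucc]
    · intro j k
      refine Fin.lastCases ?_ (fun j => ?_) j <;> refine Fin.lastCases ?_ (fun k => ?_) k
      · have h0 : ∀ i : Fin n, B (x i.castSucc) (x (Fin.last n)) = 0 := fun i =>
          hx.2 _ _ (Fin.castSucc_lt_last i).ne
        simp [S.u_eq_one (hx.1 _).1, h0]
      · have h0 : ∀ i : Fin n, B (x i.castSucc) (x k.castSucc) = if i = k then 1 else 0 := by
          intro i
          split_ifs with h
          · rw [h, hB.apply_self (hx.1 _)]
          · exact hx.2 _ _ fun h' => h (Fin.castSucc_injective n h')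
        simp [S.u_eq_one (hx.1 _).1, h0, (Fin.castSucc_lt_last k).ne']
      · simp [hx.2 _ _ (Fin.castSucc_lt_last j).ne, (Fin.castSucc_lt_last j).ne]
      · rw [Fin.snoc_castSucc]
        split_ifs with h
        · rw [h, hB.apply_self (hx.1 _)]
        · exact hx.2 _ _ h

omit [FiniteDimensional ℝ A] in
theorem isOrthoPure_of_isFrame {n : ℕ} {x : Fin n → A} (hx : S.IsFrame x) :
    S.IsOrthoPure B x := by
  refine ⟨hx.2, fun i j h => ?_⟩
  obtain ⟨v, hv, hvx⟩ := hB.extension n x hx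
  rw [← hvx, ← hvx, hB.apply_frame v hv, if_neg]
  exact fun h' => h (Fin.castLE_injective _ h')

/-- Every finite family of mutually orthogonal pure states can be completed. -/
theorem exists_completion {ι : Type*} [Fintype ι] {x : ι → A} (hx : S.IsOrthoPure B x) :
    ∃ (r : ℕ) (y : Fin r → A), S.IsOrthoPure B (Sum.elim x y) ∧ ∑ i, x i + ∑ i, y i = c := by
  let e := Fintype.equivFin ι
  have hframe := hB.isFrame_of_isOrthoPure (hx.comp e.symm.injective)
  obtain ⟨v, hv, hvx⟩ := hB.extension _ _ hframe
  have hle := hB.card_le _ _ hframe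
  obtain ⟨r, rfl⟩ := Nat.exists_eq_add_of_le hle
  have hvx' : ∀ i, v (Fin.castAdd r (e i)) = x i := fun i =>
    (hvx (e i)).trans (congrArg x (e.symm_apply_apply i))
  refine ⟨r, fun i => v (Fin.natAdd _ i), ?_, ?_⟩
  · have h := (hB.isOrthoPure_of_isFrame hv).comp
      (f := finSumFinEquiv ∘ Sum.map e id) (by
        refine finSumFinEquiv.injective.comp ?_
        exact Sum.map_injective.2 ⟨e.injective, Function.injective_id⟩)
    convert h using 1
    ext i
    rcases i with i | i
    · simp [hvx']
    · simp
  · rw [← hB.sum_frame v hv, Fin.sum_univ_add, ← Equiv.sum_comp e]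
    simp [hvx']

omit [FiniteDimensional ℝ A] in
theorem isOrthoPure_apply_sum {ι : Type*} [Fintype ι] {x : ι → A} (hx : S.IsOrthoPure B x)
    (q : ι → ℝ) (i : ι) : B (∑ j, q j • x j) (x i) = q i := by
  classical
  rw [map_sum, LinearMap.sum_apply, Finset.sum_eq_single i]
  · simp [hB.apply_self (hx.1 i)]
  · intro j _ hj
    simp [hx.2 j i hj]
  · simp

theorem unit_le {y : A} (hd : S.IsProjectionUnit B d) (hy : y ∈ S.cone) : B d y ≤ S.u y := by
  obtain ⟨m, x, hx, rfl⟩ := hd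
  simpa using hB.sum_frame_le (hB.isFrame_of_isOrthoPure hx) y hy

omit [FiniteDimensional ℝ A] in
theorem mem_faceCone_of_sum {ι : Type*} [Fintype ι] {x : ι → A} (hx : S.IsOrthoPure B x)
    (hd : ∑ i, x i = d) (i : ι) : x i ∈ S.faceCone B d := by
  refine ⟨S.mem_cone_of_mem (hx.1 i).1, ?_⟩
  rw [S.u_eq_one (hx.1 i).1, ← hd]
  simpa using hB.isOrthoPure_apply_sum hx (fun _ => 1) i

omit [FiniteDimensional ℝ A] in
theorem unit_mem_faceCone (hd : S.IsProjectionUnit B d) : d ∈ S.faceCone B d := by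
  obtain ⟨m, x, hx, hd⟩ := hd
  have := faceCone_sum_mem Finset.univ fun i _ => hB.mem_faceCone_of_sum hx hd i
  rwa [hd] at this

/-- It is the zero set of `u - B d`, which is nonnegative on the cone. -/
theorem isFace_faceCone (hd : S.IsProjectionUnit B d) : IsFace S.cone (S.faceCone B d) := by
  refine ⟨⟨0, faceCone_zero_mem⟩, fun x hx y hy s t hs ht _ =>
    faceCone_add_mem (faceCone_smul_mem hs hx) (faceCone_smul_mem ht hy), fun x hx => hx.1,
    fun v hv w hw p hp hp1 h => ?_⟩
  have h1 := hB.unit_le hd hv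
  have h2 := hB.unit_le hd hw
  have h3 := h.2
  simp only [map_add, map_smul, smul_eq_mul] at h3
  have h4 : p * (S.u v - B d v) + (1 - p) * (S.u w - B d w) = 0 := by linarith
  have h5 := mul_nonneg hp.le (sub_nonneg.2 h1)
  have h6 := mul_nonneg (sub_nonneg.2 hp1.le) (sub_nonneg.2 h2)
  have h7 : p * (S.u v - B d v) = 0 := by linarith
  have h8 : (1 - p) * (S.u w - B d w) = 0 := by linarith
  rcases mul_eq_zero.1 h7 with h | h
  · exact absurd h hp.ne'
  rcases mul_eq_zero.1 h8 with h' | h'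
  · exact absurd h' (sub_pos.2 hp1).ne'
  exact ⟨⟨hv, by linarith⟩, ⟨hw, by linarith⟩⟩

omit [FiniteDimensional ℝ A] in
/-- Every state is a mixture with positive weights of mutually orthogonal pure states. -/
theorem exists_pos_decomposition {w : A} (hw : w ∈ S.Ω) :
    ∃ (m : ℕ) (p : Fin m → ℝ) (x : Fin m → A), (∀ j, 0 < p j) ∧ ∑ j, p j = 1 ∧
      S.IsOrthoPure B x ∧ w = ∑ j, p j • x j := by
  classical
  obtain ⟨p, x, hp, hp1, hx, hw⟩ := hB.decomposition w hw
  let e := (Fintype.equivFin {j // 0 < p j}).symm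
  have hzero : ∀ i ∉ Set.range (Subtype.val : {j // 0 < p j} → Fin N), p i = 0 := by
    intro i hi
    by_contra h
    exact hi ⟨⟨i, lt_of_le_of_ne (hp i) (Ne.symm h)⟩, rfl⟩
  refine ⟨_, fun j => p (e j), fun j => x (e j), fun j => (e j).2, ?_,
    (hB.isOrthoPure_of_isFrame hx).comp (Subtype.val_injective.comp e.injective), ?_⟩
  · rw [← hp1, Equiv.sum_comp e fun j => p j]
    exact Fintype.sum_of_injective _ Subtype.val_injective _ _ hzero fun _ => rfl
  · rw [hw, Equiv.sum_comp e fun j => p j • x j]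
    refine (Fintype.sum_of_injective _ Subtype.val_injective _ _ (fun i hi => ?_) fun _ => rfl).symm
    rw [hzero i hi, zero_smul]

/-- Every element of a face of the cone has a spectral decomposition inside of the face. -/
theorem exists_decomposition_faceCone (hd : S.IsProjectionUnit B d) {w : A}
    (hw : w ∈ S.faceCone B d) : ∃ (m : ℕ) (q : Fin m → ℝ) (x : Fin m → A), (∀ j, 0 ≤ q j) ∧
      S.IsOrthoPure B x ∧ ∑ j, x j = d ∧ w = ∑ j, q j • x j := by
  obtain ⟨w', hw', hww⟩ := S.exists_eq_u_smul hw.1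
  rcases (S.u_nonneg hw.1).eq_or_lt with h0 | h0
  · obtain ⟨m, x, hx, hd⟩ := hd
    exact ⟨m, 0, x, fun _ => le_rfl, hx, hd, by rw [hww, ← h0]; simp⟩
  set t := S.u w
  have hdw : B d w' = 1 := by
    have := hw.2
    rw [hww, map_smul, map_smul, S.u_eq_one hw'] at this
    exact mul_left_cancel₀ h0.ne' this
  obtain ⟨m, p, y, hp, hp1, hy, hw'y⟩ := hB.exists_pos_decomposition hw'
  -- These values are at most 1 and average to 1 with positive weights.
  have hdy : ∀ j, B d (y j) = 1 := by
    have h1 : ∑ j, p j * (1 - B d (y j)) = 0 := by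
      rw [hw'y] at hdw
      simp only [map_sum, map_smul, smul_eq_mul] at hdw
      simp only [mul_sub, mul_one, Finset.sum_sub_distrib, hp1, hdw, sub_self]
    intro j
    have h2 := (Finset.sum_eq_zero_iff_of_nonneg fun j _ => mul_nonneg (hp j).le
      (sub_nonneg.2 ((hB.unit_le hd (S.mem_cone_of_mem (hy.1 j).1)).trans_eq
        (S.u_eq_one (hy.1 j).1)))).1 h1 j (Finset.mem_univ j)
    rcases mul_eq_zero.1 h2 with h | h
    · exact absurd h (hp j).ne'
    · linarith
  obtain ⟨n, x, hx, hxd⟩ := hd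
  obtain ⟨r, z, hxz, hsum⟩ := hB.exists_completion hx
  -- `B d` already exhausts the value 1 of `B c = u` at `y j`, leaving nothing for the complement
  -- `z`.
  have hyz : ∀ j i, B (z i) (y j) = 0 := by
    intro j i
    have h1 : ∑ i, B (z i) (y j) = 0 := by
      have : B c (y j) = 1 := by rw [hB.symm, hB.apply_center, S.u_eq_one (hy.1 j).1]
      rw [← hsum, hxd] at this
      simp only [map_add, map_sum, LinearMap.add_apply, LinearMap.sum_apply, hdy] at this
      linarith
    exact (Finset.sum_eq_zero_iff_of_nonneg fun i _ => hB.nonneg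
      (S.mem_cone_of_mem (hxz.1 (Sum.inr i)).1) (S.mem_cone_of_mem (hy.1 j).1)).1 h1 i
      (Finset.mem_univ i)
  have hyzo : S.IsOrthoPure B (Sum.elim y z) := by
    refine ⟨?_, ?_⟩
    · rintro (i | i)
      · exact hy.1 i
      · exact hxz.1 (Sum.inr i)
    · rintro (i | i) (j | j) h
      · exact hy.2 i j fun h' => h (congrArg _ h')
      · exact (hB.symm _ _).trans (hyz i j)
      · exact hyz j i
      · exact hxz.2 (Sum.inr i) (Sum.inr j) fun h' => h (congrArg _ (Sum.inr_injective h'))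
  -- Both `d` with `z` and `y`, `a` with `z` sum to `c`, so `y` and `a` together sum to `d`.
  obtain ⟨s, a, hyza, hsum'⟩ := hB.exists_completion hyzo
  have hya : S.IsOrthoPure B (Sum.elim y a) := by
    have := hyza.comp (f := Sum.map Sum.inl id) (κ := Fin m ⊕ Fin s)
      (Sum.map_injective.2 ⟨Sum.inl_injective, Function.injective_id⟩)
    convert this using 1
    ext i
    rcases i with i | i <;> simp
  refine ⟨m + s, Fin.append (fun j => t * p j) 0, Fin.append y a, fun j => ?_, ?_, ?_, ?_⟩
  · refine Fin.addCases (fun j => ?_) (fun j => ?_) j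
    · simpa using mul_nonneg h0.le (hp j).le
    · simp
  · have := hya.comp finSumFinEquiv.symm.injective
    convert this using 1
    ext i
    refine Fin.addCases (fun j => ?_) (fun j => ?_) i <;> simp
  · rw [Fin.sum_univ_add]
    simp only [Fin.append_left, Fin.append_right]
    rw [Fintype.sum_sum_type] at hsum'
    simp only [Sum.elim_inl, Sum.elim_inr] at hsum'
    rw [← hsum, hxd] at hsum'
    have : ∑ i, y i + ∑ i, a i + ∑ i, z i = d + ∑ i, z i := by rw [← hsum']; abel
    exact add_right_cancel this
  · rw [Fin.sum_univ_add]
    simp only [Fin.append_left, Fin.append_right, Pi.zero_apply, zero_smul,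
      Finset.sum_const_zero, add_zero, mul_smul]
    rw [hww, hw'y, Finset.smul_sum]

/-- The unit of a face dominates the normalized elements of the face. -/
theorem u_smul_unit_sub_mem (hd : S.IsProjectionUnit B d) {w : A} (hw : w ∈ S.faceCone B d) :
    S.u w • d - w ∈ S.faceCone B d := by
  obtain ⟨m, q, x, hq, hx, hxd, hwx⟩ := hB.exists_decomposition_faceCone hd hw
  have hu : S.u w = ∑ j, q j := by
    rw [hwx]
    simp [S.u_eq_one (hx.1 _).1]
  have h : S.u w • d - w = ∑ j, (S.u w - q j) • x j := by
    simp only [sub_smul, Finset.sum_sub_distrib, ← hwx, ← Finset.smul_sum, hxd]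
  rw [h]
  refine faceCone_sum_mem _ fun j _ => faceCone_smul_mem (sub_nonneg.2 ?_)
    (hB.mem_faceCone_of_sum hx hxd j)
  rw [hu]
  exact Finset.single_le_sum (f := q) (fun i _ => hq i) (Finset.mem_univ j)

/-- The faces of the cone are self-dual in their linear spans. -/
theorem mem_faceCone_of_nonneg (hd : S.IsProjectionUnit B d) {x : A}
    (hx : x ∈ Submodule.span ℝ (S.faceCone B d)) (hpos : ∀ y ∈ S.faceCone B d, 0 ≤ B x y) :
    x ∈ S.faceCone B d := by
  obtain ⟨a, ha, b, hb, hab⟩ := faceCone_exists_eq_sub hx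
  -- Shifting `x` by `u b • d` brings it into the face. The decomposition there sums to `d`, so
  -- undoing the shift leaves `x` diagonal, with coefficients `B x (v j)`.
  have h1 := faceCone_add_mem ha (hB.u_smul_unit_sub_mem hd hb)
  obtain ⟨m, q, v, hq, hv, hvd, hqv⟩ := hB.exists_decomposition_faceCone hd h1
  have h2 : x = ∑ j, (q j - S.u b) • v j := by
    simp only [sub_smul, Finset.sum_sub_distrib, ← hqv, ← Finset.smul_sum, hvd, hab]
    abel
  have hmem := hB.mem_faceCone_of_sum hv hvd
  rw [h2] at hpos ⊢
  refine faceCone_sum_mem _ fun j _ => faceCone_smul_mem ?_ (hmem j)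
  rw [← hB.isOrthoPure_apply_sum hv (fun j => q j - S.u b) j]
  exact hpos _ (hmem j)

/-- Elements of the two faces are dominated by multiples of `d` and `d'`, and `B` is monotone on the
cone. -/
theorem orthogonal_faceCone {d' : A} (hd : S.IsProjectionUnit B d) (hd' : S.IsProjectionUnit B d')
    (h : B d d' = 0) {x y : A} (hx : x ∈ Submodule.span ℝ (S.faceCone B d))
    (hy : y ∈ Submodule.span ℝ (S.faceCone B d')) : B x y = 0 := by
  have key : ∀ x ∈ S.faceCone B d, ∀ y ∈ S.faceCone B d', B x y = 0 := by
    intro x hx y hy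
    have h1 := hB.nonneg (hB.u_smul_unit_sub_mem hd hx).1 hy.1
    have h2 := hB.nonneg (hB.unit_mem_faceCone hd).1 (hB.u_smul_unit_sub_mem hd' hy).1
    have h3 := hB.nonneg hx.1 hy.1
    have h4 := hB.nonneg (hB.unit_mem_faceCone hd).1 hy.1
    simp only [map_sub, map_smul, LinearMap.sub_apply, LinearMap.smul_apply, smul_eq_mul,
      h] at h1 h2
    have h5 : B d y = 0 := by linarith
    rw [h5] at h1
    linarith
  obtain ⟨a, ha, b, hb, rfl⟩ := faceCone_exists_eq_sub hx
  obtain ⟨a', ha', b', hb', rfl⟩ := faceCone_exists_eq_sub hy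
  simp [key a ha a' ha', key a ha b' hb', key b hb a' ha', key b hb b' hb']

section Projection

variable {P : A →ₗ[ℝ] A}

/-- The orthogonal projection onto the linear span of a face of the cone is positive. -/
theorem projection_mem_faceCone (hd : S.IsProjectionUnit B d)
    (hP : IsOrthogonalProjection B P (Submodule.span ℝ (S.faceCone B d))) {x : A}
    (hx : x ∈ S.cone) : P x ∈ S.faceCone B d := by
  -- For `y` in the face, `B (P x) y = B x y ≥ 0`; self-duality of the face does the rest.
  refine hB.mem_faceCone_of_nonneg hd (hP.apply_mem x) fun y hy => ?_
  rw [hP.2.2, hP.apply_of_mem (Submodule.subset_span hy)]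
  exact hB.nonneg hx hy.1

omit [FiniteDimensional ℝ A] in
-- `c - d` is orthogonal to the face, so `P c = d`; now move `P` across `B (P x) c`.
theorem u_projection (hd : S.IsProjectionUnit B d)
    (hP : IsOrthogonalProjection B P (Submodule.span ℝ (S.faceCone B d))) (x : A) :
    S.u (P x) = B d x := by
  have hc : P (c - d) = 0 := by
    refine hP.apply_eq_zero (fun x => hB.pos) fun y hy => ?_
    have key : ∀ a ∈ S.faceCone B d, B (c - d) a = 0 := by
      intro a ha
      rw [map_sub, LinearMap.sub_apply, hB.symm, hB.apply_center, ha.2, sub_self]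
    obtain ⟨a, ha, b, hb, rfl⟩ := faceCone_exists_eq_sub hy
    rw [map_sub, key a ha, key b hb, sub_self]
  rw [map_sub, hP.apply_of_mem (Submodule.subset_span (hB.unit_mem_faceCone hd)),
    sub_eq_zero] at hc
  rw [← hB.apply_center, hP.2.2, hc, hB.symm]

end Projection

/-- Mutually orthogonal units of faces that sum to the center yield a projective measurement. -/
theorem exists_projectiveMeasurement {α : Type*} [Fintype α] [DecidableEq α] {d : α → A}
    (hd : ∀ a, S.IsProjectionUnit B (d a)) (horth : ∀ a b, a ≠ b → B (d a) (d b) = 0)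
    (hsum : ∑ a, d a = c) : ∃ P : α → A →ₗ[ℝ] A, S.IsProjectiveMeasurement B P ∧
      (∀ a, IsOrthogonalProjection B (P a) (Submodule.span ℝ (S.faceCone B (d a)))) ∧
      ∀ a b, ∀ x ∈ S.faceCone B (d b), P a x = if a = b then x else 0 := by
  choose P hP using fun a => exists_isOrthogonalProjection hB.symm (fun x => hB.pos)
    (Submodule.span ℝ (S.faceCone B (d a)))
  have hzero : ∀ a b, a ≠ b → ∀ x ∈ Submodule.span ℝ (S.faceCone B (d b)), P a x = 0 :=
    fun a b h x hx => (hP a).apply_eq_zero (fun x => hB.pos) fun y hy =>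
      hB.orthogonal_faceCone (hd b) (hd a) (horth b a h.symm) hx hy
  refine ⟨P, ⟨⟨fun a => ⟨fun x hx => (hB.projection_mem_faceCone (hd a) (hP a) hx).1,
    fun x hx => ?_⟩, ?_⟩, fun a => ⟨_, hB.isFace_faceCone (hd a), hP a⟩, fun a b h => ?_⟩, hP,
    fun a b x hx => ?_⟩
  · rw [LinearMap.comp_apply, hB.u_projection (hd a) (hP a)]
    exact hB.unit_le (hd a) hx
  · ext x
    simp only [LinearMap.sum_apply, LinearMap.comp_apply]
    rw [Finset.sum_congr rfl fun a _ => hB.u_projection (hd a) (hP a) x, ← hB.apply_center,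
      hB.symm, ← hsum, map_sum, LinearMap.sum_apply]
  · ext x
    exact hzero a b h _ ((hP b).apply_mem x)
  · split_ifs with h
    · subst h
      exact (hP a).apply_of_mem (Submodule.subset_span hx)
    · exact hzero a b h x (Submodule.subset_span hx)

/-- A state `w` with `B v w = 1` equals `v`, by the equality case of Cauchy–Schwarz. -/
theorem coneOver_singleton_eq {v : A} (hv : S.IsPure v) : coneOver {v} = S.faceCone B v := by
  ext y
  constructor
  · rintro ⟨t, ht, w, rfl, rfl⟩
    exact faceCone_smul_mem ht (hB.unit_mem_faceCone (IsPure.isProjectionUnit hv))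
  · rintro ⟨hy, hvy⟩
    obtain ⟨w, hw, hyw⟩ := S.exists_eq_u_smul hy
    refine ⟨S.u y, S.u_nonneg hy, v, rfl, ?_⟩
    rcases (S.u_nonneg hy).eq_or_lt with h0 | h0
    · rw [hyw]
      simp [← h0]
    have hvw : B v w = 1 := by
      rw [hyw, map_smul, map_smul, S.u_eq_one hw] at hvy
      exact mul_left_cancel₀ h0.ne' hvy
    have h : w - v = 0 := by
      by_contra h
      have h1 := hB.pos h
      have h2 := (hB.isSelfDualizing.mem_Icc w hw w hw).2
      simp only [map_sub, LinearMap.sub_apply, hB.symm w v, hvw, hB.apply_self hv] at h1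
      linarith
    rw [← sub_eq_zero.1 h]
    exact hyw

/-- The face generated by a state is cut out by a sum of mutually orthogonal pure states. -/
theorem exists_unit_of_state {w : A} (hw : w ∈ S.Ω) : ∃ (m : ℕ) (x : Fin m → A) (s : ℝ),
    S.IsOrthoPure B x ∧ 0 < s ∧ w - s • ∑ i, x i ∈ S.cone ∧
      coneOver (generatedFace S.Ω {w}) = S.faceCone B (∑ i, x i) ∧
      w ∈ S.faceCone B (∑ i, x i) := by
  obtain ⟨m, p, x, hp, hp1, hx, hwx⟩ := hB.exists_pos_decomposition hw
  have hne : (Finset.univ : Finset (Fin m)).Nonempty := by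
    by_contra h
    rw [Finset.not_nonempty_iff_eq_empty] at h
    simp [h] at hp1
  -- With the smallest weight `p k`, the state `w` dominates `p k • d`.
  obtain ⟨k, -, hk⟩ := Finset.exists_min_image Finset.univ p hne
  have hd := hx.isProjectionUnit
  set d := ∑ i, x i with hdx
  have hwd : w - p k • d ∈ S.cone := by
    have : w - p k • d = ∑ j, (p j - p k) • x j := by
      simp only [sub_smul, Finset.sum_sub_distrib, ← hwx, ← Finset.smul_sum, hdx]
    rw [this]
    exact S.sum_mem_cone _ fun j _ => S.smul_mem_cone (sub_nonneg.2 (hk j (Finset.mem_univ j)))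
      (S.mem_cone_of_mem (hx.1 j).1)
  have hwmem : w ∈ S.faceCone B d := by
    rw [hwx]
    exact faceCone_sum_mem _ fun j _ => faceCone_smul_mem (hp j).le
      (hB.mem_faceCone_of_sum hx rfl j)
  have hgen : generatedFace S.Ω {w} = {y | y ∈ S.Ω ∧ y ∈ S.faceCone B d} := by
    refine Set.Subset.antisymm (Set.sInter_subset_of_mem ⟨⟨⟨w, hw, hwmem⟩, ?_, fun y hy => hy.1,
      ?_⟩, Set.singleton_subset_iff.2 ⟨hw, hwmem⟩⟩) ?_
    · exact S.convex.inter (hB.isFace_faceCone hd).2.1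
    · intro v hv v' hv' t ht ht1 h
      have := (hB.isFace_faceCone hd).2.2.2 v (S.mem_cone_of_mem hv) v' (S.mem_cone_of_mem hv') t
        ht ht1 h.2
      exact ⟨⟨hv, this.1⟩, ⟨hv', this.2⟩⟩
    -- `d` dominates `y`, so `y` occurs in `w` with weight `p k` and lies in every face containing
    -- `w`.
    · rintro y ⟨hy, hyd⟩ H ⟨hH, hwH⟩
      refine S.mem_face_of_sub_smul_mem_cone hH (Set.singleton_subset_iff.1 hwH) hy (hp k) ?_
      have h1 := (hB.u_smul_unit_sub_mem hd hyd).1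
      rw [S.u_eq_one hy, one_smul] at h1
      have := S.add_mem_cone hwd (S.smul_mem_cone (hp k).le h1)
      rwa [smul_sub, sub_add_sub_cancel] at this
  refine ⟨m, x, p k, hx, hp k, hwd, ?_, hwmem⟩
  rw [hgen]
  ext y
  constructor
  · rintro ⟨t, ht, v, hv, rfl⟩
    exact faceCone_smul_mem ht hv.2
  · intro hy
    obtain ⟨v, hv, hyv⟩ := S.exists_eq_u_smul hy.1
    rcases (S.u_nonneg hy.1).eq_or_lt with h0 | h0
    · exact ⟨0, le_rfl, w, ⟨hw, hwmem⟩, by rw [hyv, ← h0, zero_smul, zero_smul]⟩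
    · refine ⟨S.u y, h0.le, v, ⟨hv, ?_⟩, hyv⟩
      have := faceCone_smul_mem (inv_nonneg.2 h0.le) hy
      rwa [hyv, map_smul, S.u_eq_one hv, smul_eq_mul, mul_one, inv_smul_smul₀ h0.ne'] at this

end IsFrameForm

end DynamicalStateSpace

-- Projective measurements for distinguishable states and maximal frames

theorem DynamicalStateSpace.PerfectlyDistinguishable.pair {A : Type*} [AddCommGroup A] [Module ℝ A]
    [TopologicalSpace A] {S : DynamicalStateSpace A} {n : ℕ} {w : Fin n → A}
    (hw : S.PerfectlyDistinguishable w) {j k : Fin n} (hjk : j ≠ k) :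
    S.PerfectlyDistinguishable ![w j, w k] := by
  have h : ![w j, w k] = w ∘ ![j, k] := by
    ext i
    fin_cases i <;> rfl
  rw [h]
  exact hw.comp ⟨![j, k], by
    intro a b
    fin_cases a <;> fin_cases b <;> simp [hjk, hjk.symm]⟩

namespace DynamicalStateSpace.IsFrameForm

variable {A : Type*} [AddCommGroup A] [Module ℝ A] [TopologicalSpace A] {S : DynamicalStateSpace A}
  [FiniteDimensional ℝ A] {N : ℕ} {B : LinearMap.BilinForm ℝ A} {c : A}
  (hB : S.IsFrameForm N B c)
include hB

theorem distinguishable_projectiveMeasurement {n : ℕ} {w : Fin n → A}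
    (hw : S.PerfectlyDistinguishable w) :
    ∃ (r : ℕ) (v : Fin r → A) (P : Fin n ⊕ Fin r → A →ₗ[ℝ] A),
      S.IsFrame v ∧
      S.IsProjectiveMeasurement B P ∧
      (∀ j, IsOrthogonalProjection B (P (Sum.inl j))
        (Submodule.span ℝ (coneOver (generatedFace S.Ω {w j})))) ∧
      (∀ i, IsOrthogonalProjection B (P (Sum.inr i)) (Submodule.span ℝ (coneOver {v i}))) ∧
      ∀ a k, P a (w k) = if a = Sum.inl k then w k else 0 := by
  choose m x s hx hs hsw hface hmem using fun j => hB.exists_unit_of_state (hw.1 j)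
  have hdw : ∀ j, ∑ i, x j i ∈ S.cone := fun j =>
    S.sum_mem_cone _ fun i _ => S.mem_cone_of_mem ((hx j).1 i).1
  -- Each `w j` dominates a positive multiple of its unit, so orthogonality of the states passes to
  -- the units, and from these to their summands.
  have hd : ∀ j k, j ≠ k → B (∑ i, x j i) (∑ i, x k i) = 0 := by
    intro j k hjk
    have h0 := hB.isSelfDualizing.orthogonal _ _ (hw.pair hjk)
    have h1 := hB.nonneg (hsw j) (S.mem_cone_of_mem (hw.1 k))
    have h2 := hB.nonneg (hdw j) (hsw k)
    have h3 := hB.nonneg (hdw j) (hdw k)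
    have h4 := hB.nonneg (hdw j) (S.mem_cone_of_mem (hw.1 k))
    rw [map_sub, LinearMap.sub_apply, map_smul, LinearMap.smul_apply, smul_eq_mul, h0] at h1
    rw [map_sub, map_smul, smul_eq_mul] at h2
    have h5 : B (∑ i, x j i) (w k) = 0 := by nlinarith [hs j]
    rw [h5] at h2
    nlinarith [hs k]
  have hX : S.IsOrthoPure B (fun q : Σ j, Fin (m j) => x q.1 q.2) := by
    refine ⟨fun q => (hx q.1).1 q.2, ?_⟩
    rintro ⟨j, i⟩ ⟨k, l⟩ h
    by_cases hjk : j = k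
    · subst hjk
      exact (hx j).2 i l fun h' => h (by rw [h'])
    · have hle : ∀ j i, (∑ i, x j i) - x j i ∈ S.cone := by
        intro j i
        rw [← Finset.sum_erase_eq_sub (Finset.mem_univ i)]
        exact S.sum_mem_cone _ fun i _ => S.mem_cone_of_mem ((hx j).1 i).1
      have h1 := hB.nonneg (hle j i) (hdw k)
      have h2 := hB.nonneg (S.mem_cone_of_mem ((hx j).1 i).1) (hle k l)
      have h3 := hB.nonneg (S.mem_cone_of_mem ((hx j).1 i).1) (S.mem_cone_of_mem ((hx k).1 l).1)
      rw [map_sub, LinearMap.sub_apply, hd j k hjk] at h1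
      rw [map_sub] at h2
      change B (x j i) (x k l) = 0
      linarith
  obtain ⟨r, v, hv, hsum⟩ := hB.exists_completion hX
  have hvv : S.IsOrthoPure B v := hv.comp Sum.inr_injective
  let d : Fin n ⊕ Fin r → A := Sum.elim (fun j => ∑ i, x j i) v
  have hdunit : ∀ a, S.IsProjectionUnit B (d a) := by
    rintro (j | i)
    · exact (hx j).isProjectionUnit
    · exact IsPure.isProjectionUnit (hvv.1 i)
  have hcross : ∀ j i, B (∑ l, x j l) (v i) = 0 := by
    intro j i
    rw [map_sum, LinearMap.sum_apply]
    exact Finset.sum_eq_zero fun l _ => hv.2 (Sum.inl ⟨j, l⟩) (Sum.inr i) Sum.inl_ne_inr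
  have hdorth : ∀ a b, a ≠ b → B (d a) (d b) = 0 := by
    rintro (j | i) (k | l) h
    · exact hd j k fun h' => h (congrArg _ h')
    · exact hcross j l
    · exact (hB.symm _ _).trans (hcross k i)
    · exact hvv.2 i l fun h' => h (congrArg _ h')
  have hdsum : ∑ a, d a = c := by
    rw [Fintype.sum_sum_type, ← hsum, Fintype.sum_sigma]
    rfl
  obtain ⟨P, hPM, hP, hPw⟩ := hB.exists_projectiveMeasurement hdunit hdorth hdsum
  refine ⟨r, v, P, hB.isFrame_of_isOrthoPure hvv, hPM, fun j => ?_, fun i => ?_, fun a k =>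
    hPw a (Sum.inl k) _ (hmem k)⟩
  · rw [hface]
    exact hP (Sum.inl j)
  · rw [hB.coneOver_singleton_eq (hvv.1 i)]
    exact hP (Sum.inr i)

theorem maximalFrame_projectiveMeasurement {n : ℕ} {w : Fin n → A} (hw : S.IsMaximalFrame w) :
    ∃ P : Fin n → A →ₗ[ℝ] A,
      S.IsProjectiveMeasurement B P ∧
      (∀ j, IsOrthogonalProjection B (P j) (Submodule.span ℝ (coneOver {w j}))) ∧
      ∀ j k, P j (w k) = if j = k then w k else 0 := by
  obtain ⟨hframe, hmax⟩ := hw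
  have hx := hB.isOrthoPure_of_isFrame hframe
  -- A frame that is maximal for inclusion has size `N`, since every frame extends to that size;
  -- hence its sum is `c`.
  have hn : n = N := by
    refine le_antisymm (hB.card_le n w hframe) ?_
    obtain ⟨v, hv, hvw⟩ := hB.extension n w hframe
    exact hmax N v hv (Set.range_subset_iff.2 fun i => ⟨_, hvw i⟩)
  subst hn
  obtain ⟨P, hPM, hP, hPw⟩ := hB.exists_projectiveMeasurement
    (fun j => IsPure.isProjectionUnit (hx.1 j)) hx.2 (hB.sum_frame w hframe)
  refine ⟨P, hPM, fun j => ?_, fun j k =>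
    hPw j k _ (hB.unit_mem_faceCone (IsPure.isProjectionUnit (hx.1 k)))⟩
  rw [hB.coneOver_singleton_eq (hx.1 j)]
  exact hP j

end DynamicalStateSpace.IsFrameForm

theorem mainTheorem8 {A : Type*} [AddCommGroup A] [Module ℝ A] [FiniteDimensional ℝ A]
    [TopologicalSpace A] [IsTopologicalAddGroup A] [ContinuousSMul ℝ A] [T2Space A]
    (S : DynamicalStateSpace A) (h1 : S.ClassicalDecomposability) (h2 : S.StrongSymmetry) :
    ∃ B : LinearMap.BilinForm ℝ A, S.IsSelfDualizing B ∧
      -- perfectly distinguishable states, possibly mixed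
      (∀ (n : ℕ) (w : Fin n → A), S.PerfectlyDistinguishable w →
        ∃ (r : ℕ) (v : Fin r → A) (P : Fin n ⊕ Fin r → A →ₗ[ℝ] A),
          S.IsFrame v ∧
          S.IsProjectiveMeasurement B P ∧
          (∀ j, IsOrthogonalProjection B (P (Sum.inl j))
            (Submodule.span ℝ (coneOver (generatedFace S.Ω {w j})))) ∧
          (∀ i, IsOrthogonalProjection B (P (Sum.inr i))
            (Submodule.span ℝ (coneOver {v i}))) ∧
          (∀ a k, S.u (P a (w k)) = if a = Sum.inl k then 1 else 0) ∧
          (∀ a k, P a (w k) = if a = Sum.inl k then w k else 0)) ∧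
      -- maximal frames
      (∀ (n : ℕ) (w : Fin n → A), S.IsMaximalFrame w →
        ∃ P : Fin n → A →ₗ[ℝ] A,
          S.IsProjectiveMeasurement B P ∧
          (∀ j, IsOrthogonalProjection B (P j) (Submodule.span ℝ (coneOver {w j}))) ∧
          (∀ j k, S.u (P j (w k)) = if j = k then 1 else 0) ∧
          (∀ j k, P j (w k) = if j = k then w k else 0)) := by
  obtain ⟨N, B, c, hB⟩ := S.exists_isFrameForm h1 h2
  refine ⟨B, hB.isSelfDualizing, fun n w hw => ?_, fun n w hw => ?_⟩
  · obtain ⟨r, v, P, hv, hPM, hP, hPv, hPw⟩ := hB.distinguishable_projectiveMeasurement hw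
    refine ⟨r, v, P, hv, hPM, hP, hPv, fun a k => ?_, hPw⟩
    rw [hPw]
    split_ifs
    · exact S.u_eq_one (hw.1 k)
    · exact map_zero _
  · obtain ⟨P, hPM, hP, hPw⟩ := hB.maximalFrame_projectiveMeasurement hw
    refine ⟨P, hPM, hP, fun j k => ?_, hPw⟩
    rw [hPw]
    split_ifs
    · exact S.u_eq_one (hw.1.1.1 k)
    · exact map_zero _
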